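/- Let $\mathcal H$ be a complex Hilbert space and let $\mathcal B(\mathcal H)_*$ be the predual of $\mathcal B(\mathcal H)$. A unitary $W\in\mathcal B(\mathcal H\otimes\mathcal H)$ is called multiplicative if $W_{12}W_{13}W_{23}=W_{23}W_{12}$. Put $$S=\{(\iota\otimes\omega)(W)\mid\omega\in\mathcal B(\mathcal H)_*\},\qquad \widehat S=\{(\omega\otimes\iota)(W)\mid\omega\in\mathcal B(\mathcal H)_*\},$$ and let $M$ and $\widehat M$ be the von Neumann algebras generated by $S$ and $\widehat S$. A quantum group frame on $\mathcal H$ is a triple $(W,J,\widehat J)$ such that 1. $W$ is a multiplicative unitary on $\mathcal H$; 2. $W$ is trim: the linear span of $\{s\,\widehat s^{\,*}\mid s\in S,\ \widehat s\in\widehat S\}$ is $\sigma$-weakly dense in $\mathcal B(\mathcal H)$; 3. $J$ and $\widehat J$ are antilinear operators on $\mathcal H$ with $J=J^*$, $J^2=1$, $\widehat J=\widehat J^*$, $\widehat J^2=1$ and $W^*=(\widehat J\otimes J)W(\widehat J\otimes J)$; 4. $JMJ\subseteq M'$ and $\widehat J\widehat M\widehat J\subseteq\widehat M'$. Let $\Sigma$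 be the flip on $\mathcal H\otimes\mathcal H$, let $\sigma(X)=\Sigma X\Sigma$, and let $\widehat W=\Sigma W^*\Sigma$. Write $M\otimes M$ for the von Neumann algebraic tensor product. **Proposition.** Let $(W,J,\widehat J)$ be a quantum group frame on $\mathcal H$. Then $$\Phi(m)=W^*(1\otimes m)W,\qquad \widehat\Phi(x)=\widehat W^*(1\otimes x)\widehat W$$ define unital $*$-homomorphisms $\Phi:M\to M\otimes M$ and $\widehat\Phi:\widehat M\to\widehat M\otimes\widehat M$, and $$R(m)=\widehat Jm^*\widehat J,\qquad \widehat R(x)=Jx^*J$$ define $*$-anti-automorphisms $R$ of $M$ and $\widehat R$ of $\widehat M$. The $\sigma$-weakly continuous linear maps $R\otimes R$ on $M\otimes M$ and $\widehat R\otimes\widehat R$ on $\widehat M\otimes\widehat M$, given on elementary tensors by $a\otimes b\mapsto R(a)\otimes R(b)$ and $a\otimes b\mapsto\widehat R(a)\otimes\widehat R(b)$, exist, and $$\Phi\circ R=\sigma\circ(R\otimes R)\circ\Phi,\qquad \widehat\Phi\circ\widehat R=\sigma\circ(\widehat R\otimes\widehat R)\circ\widehat\Phi .$$ -/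

import Mathlib

open scoped TensorProduct InnerProductSpace Topology

noncomputable section

namespace QGF

universe u v w

section HilbertTensor

/-- The Hilbert space tensor product `H ⊗ K`: the completion of the algebraic tensor product
for `⟪a ⊗ b, c ⊗ d⟫ = ⟪a, c⟫ * ⟪b, d⟫`. -/
def HTensor (H : Type u) (K : Type v) [NormedAddCommGroup H] [InnerProductSpace ℂ H]
    [NormedAddCommGroup K] [InnerProductSpace ℂ K] : Type (max u v) :=
  UniformSpace.Completion (H ⊗[ℂ] K)

instance instNormedAddCommGroupHTensor (H : Type u) (K : Type v) [NormedAddCommGroup H]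
    [InnerProductSpace ℂ H] [NormedAddCommGroup K] [InnerProductSpace ℂ K] :
    NormedAddCommGroup (HTensor H K) :=
  inferInstanceAs (NormedAddCommGroup (UniformSpace.Completion (H ⊗[ℂ] K)))

instance instInnerProductSpaceHTensor (H : Type u) (K : Type v) [NormedAddCommGroup H]
    [InnerProductSpace ℂ H] [NormedAddCommGroup K] [InnerProductSpace ℂ K] :
    InnerProductSpace ℂ (HTensor H K) :=
  inferInstanceAs (InnerProductSpace ℂ (UniformSpace.Completion (H ⊗[ℂ] K)))

instance instCompleteSpaceHTensor (H : Type u) (K : Type v) [NormedAddCommGroup H]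
    [InnerProductSpace ℂ H] [NormedAddCommGroup K] [InnerProductSpace ℂ K] :
    CompleteSpace (HTensor H K) :=
  inferInstanceAs (CompleteSpace (UniformSpace.Completion (H ⊗[ℂ] K)))

variable {H : Type u} [NormedAddCommGroup H] [InnerProductSpace ℂ H]
  {K : Type v} [NormedAddCommGroup K] [InnerProductSpace ℂ K]
  {L : Type w} [NormedAddCommGroup L] [InnerProductSpace ℂ L]

/-- The embedding of the algebraic tensor product into the Hilbert space tensor product. -/
def emb (H : Type u) (K : Type v) [NormedAddCommGroup H] [InnerProductSpace ℂ H]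
    [NormedAddCommGroup K] [InnerProductSpace ℂ K] : H ⊗[ℂ] K →ₗᵢ[ℂ] HTensor H K :=
  (UniformSpace.Completion.toComplₗᵢ : H ⊗[ℂ] K →ₗᵢ[ℂ] UniformSpace.Completion (H ⊗[ℂ] K))

/-- The elementary tensor `ξ ⊗ η` as a vector of the Hilbert space tensor product. -/
def htmul (ξ : H) (η : K) : HTensor H K := emb H K (ξ ⊗ₜ[ℂ] η)

theorem denseRange_emb : DenseRange (emb H K) :=
  UniformSpace.Completion.denseRange_coe

theorem inner_htmul (a c : H) (b d : K) :
    ⟪htmul a b, htmul c d⟫_ℂ = ⟪a, c⟫_ℂ * ⟪b, d⟫_ℂ := by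
  simp [htmul]

/-- `ξ ↦ (η ↦ ξ ⊗ η)`, continuous and linear in both variables. -/
def mkLeft (H : Type u) (K : Type v) [NormedAddCommGroup H] [InnerProductSpace ℂ H]
    [NormedAddCommGroup K] [InnerProductSpace ℂ K] : H →L[ℂ] K →L[ℂ] HTensor H K :=
  (ContinuousLinearMap.compL ℂ K (H ⊗[ℂ] K) (HTensor H K)
    (emb H K).toContinuousLinearMap).comp (TensorProduct.mkL ℂ H K)

/-- `η ↦ (ξ ↦ ξ ⊗ η)`, continuous and linear in both variables. -/
def mkRight (H : Type u) (K : Type v) [NormedAddCommGroup H] [InnerProductSpace ℂ H]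
    [NormedAddCommGroup K] [InnerProductSpace ℂ K] : K →L[ℂ] H →L[ℂ] HTensor H K :=
  (mkLeft H K).flip

theorem mkLeft_apply (ξ : H) (η : K) : mkLeft H K ξ η = htmul ξ η := rfl

theorem mkRight_apply (ξ : H) (η : K) : mkRight H K η ξ = htmul ξ η := rfl

/-- The operator `x ⊗ y` on the Hilbert space tensor product, for bounded operators `x`, `y`. -/
def opTensor (x : H →L[ℂ] H) (y : K →L[ℂ] K) : HTensor H K →L[ℂ] HTensor H K :=
  ((emb H K).toLinearMap ∘ₗ TensorProduct.map x.toLinearMap y.toLinearMap).extendOfNorm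
    (emb H K).toLinearMap

theorem opTensor_emb (x : H →L[ℂ] H) (y : K →L[ℂ] K) (t : H ⊗[ℂ] K) :
    opTensor x y (emb H K t) = emb H K (TensorProduct.map x.toLinearMap y.toLinearMap t) :=
  LinearMap.extendOfNorm_eq denseRange_emb ⟨‖TensorProduct.mapL x y‖, fun s => by
    have h := (TensorProduct.mapL x y).le_opNorm s
    rw [TensorProduct.mapL_apply] at h
    exact ((emb H K).norm_map _).trans_le
      (h.trans_eq (congrArg (_ * ·) ((emb H K).norm_map s).symm))⟩ t

theorem opTensor_htmul (x : H →L[ℂ] H) (y : K →L[ℂ] K) (ξ : H) (η : K) :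
    opTensor x y (htmul ξ η) = htmul (x ξ) (y η) :=
  opTensor_emb x y _

/-- The flip `Σ : H ⊗ K → K ⊗ H`, `ξ ⊗ η ↦ η ⊗ ξ`. -/
def flip (H : Type u) (K : Type v) [NormedAddCommGroup H] [InnerProductSpace ℂ H]
    [NormedAddCommGroup K] [InnerProductSpace ℂ K] : HTensor H K ≃ₗᵢ[ℂ] HTensor K H :=
  (TensorProduct.comm ℂ H K).extendOfIsometry (emb H K).toLinearMap (emb K H).toLinearMap
    denseRange_emb denseRange_emb (fun t => by simp)

theorem flip_htmul (ξ : H) (η : K) : flip H K (htmul ξ η) = htmul η ξ :=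
  (LinearEquiv.extendOfIsometry_eq _ (emb H K).toLinearMap (emb K H).toLinearMap
    denseRange_emb denseRange_emb _ (ξ ⊗ₜ[ℂ] η)).trans (by simp [htmul])

/-- `(H ⊙ K) ⊙ L → (H ⊗ K) ⊗ L`. -/
def embLeft (H : Type u) (K : Type v) (L : Type w) [NormedAddCommGroup H] [InnerProductSpace ℂ H]
    [NormedAddCommGroup K] [InnerProductSpace ℂ K] [NormedAddCommGroup L]
    [InnerProductSpace ℂ L] : (H ⊗[ℂ] K) ⊗[ℂ] L →ₗᵢ[ℂ] HTensor (HTensor H K) L :=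
  (emb (HTensor H K) L).comp (TensorProduct.mapIsometry (emb H K) LinearIsometry.id)

/-- `H ⊙ (K ⊙ L) → H ⊗ (K ⊗ L)`. -/
def embRight (H : Type u) (K : Type v) (L : Type w) [NormedAddCommGroup H]
    [InnerProductSpace ℂ H] [NormedAddCommGroup K] [InnerProductSpace ℂ K]
    [NormedAddCommGroup L] [InnerProductSpace ℂ L] :
    H ⊗[ℂ] (K ⊗[ℂ] L) →ₗᵢ[ℂ] HTensor H (HTensor K L) :=
  (emb H (HTensor K L)).comp (TensorProduct.mapIsometry LinearIsometry.id (emb K L))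

theorem dense_of_htmul (p : Submodule ℂ (HTensor H K))
    (h : ∀ ξ η, htmul ξ η ∈ closure (p : Set (HTensor H K))) : Dense (p : Set (HTensor H K)) := by
  have h1 : ∀ t : H ⊗[ℂ] K, emb H K t ∈ p.topologicalClosure := by
    intro t
    induction t using TensorProduct.induction_on with
    | zero => rw [map_zero]; exact zero_mem _
    | tmul ξ η => exact h ξ η
    | add s t hs ht => rw [map_add]; exact add_mem hs ht
  intro z
  exact closure_minimal (by rintro _ ⟨t, rfl⟩; exact h1 t) isClosed_closure (denseRange_emb z)

theorem denseRange_embLeft : DenseRange (embLeft H K L) := by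
  have h : Dense ((embLeft H K L).toLinearMap.range : Set (HTensor (HTensor H K) L)) := by
    refine dense_of_htmul _ fun ξ η => ?_
    have hc : Continuous fun z : HTensor H K => htmul z η :=
      (mkRight (HTensor H K) L η).continuous
    refine map_mem_closure (f := fun z : HTensor H K => htmul z η) hc (denseRange_emb ξ) ?_
    rintro _ ⟨t, rfl⟩
    exact ⟨t ⊗ₜ η, rfl⟩
  exact h

theorem denseRange_embRight : DenseRange (embRight H K L) := by
  have h : Dense ((embRight H K L).toLinearMap.range : Set (HTensor H (HTensor K L))) := by
    refine dense_of_htmul _ fun ξ η => ?_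
    have hc : Continuous fun z : HTensor K L => htmul ξ z :=
      (mkLeft H (HTensor K L) ξ).continuous
    refine map_mem_closure (f := fun z : HTensor K L => htmul ξ z) hc (denseRange_emb η) ?_
    rintro _ ⟨t, rfl⟩
    exact ⟨ξ ⊗ₜ t, rfl⟩
  exact h

/-- The associativity isomorphism `(H ⊗ K) ⊗ L ≃ H ⊗ (K ⊗ L)`. -/
def assoc (H : Type u) (K : Type v) (L : Type w) [NormedAddCommGroup H] [InnerProductSpace ℂ H]
    [NormedAddCommGroup K] [InnerProductSpace ℂ K] [NormedAddCommGroup L]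
    [InnerProductSpace ℂ L] : HTensor (HTensor H K) L ≃ₗᵢ[ℂ] HTensor H (HTensor K L) :=
  (TensorProduct.assoc ℂ H K L).extendOfIsometry (embLeft H K L).toLinearMap
    (embRight H K L).toLinearMap denseRange_embLeft denseRange_embRight
    (fun t => ((embRight H K L).norm_map _).trans
      (((TensorProduct.assocIsometry ℂ H K L).norm_map t).trans ((embLeft H K L).norm_map t).symm))

theorem assoc_htmul (ξ : H) (η : K) (ζ : L) :
    assoc H K L (htmul (htmul ξ η) ζ) = htmul ξ (htmul η ζ) :=
  (LinearEquiv.extendOfIsometry_eq _ (embLeft H K L).toLinearMap (embRight H K L).toLinearMap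
    denseRange_embLeft denseRange_embRight _ ((ξ ⊗ₜ[ℂ] η) ⊗ₜ[ℂ] ζ)).trans
    (by simp [htmul, embRight])

/-- The flip `σ` on operators: `σ(X) = Σ X Σ`. -/
def flipOp (X : HTensor H H →L[ℂ] HTensor H H) : HTensor H H →L[ℂ] HTensor H H :=
  (flip H H : HTensor H H →L[ℂ] HTensor H H) ∘L X ∘L (flip H H : HTensor H H →L[ℂ] HTensor H H)

/-- Leg numbering: `W₁₂ = W ⊗ 1` on `H ⊗ H ⊗ H`, realised as `(H ⊗ H) ⊗ H`. -/
def leg12 (W : HTensor H H →L[ℂ] HTensor H H) :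
    HTensor (HTensor H H) H →L[ℂ] HTensor (HTensor H H) H :=
  opTensor W 1

/-- Leg numbering: `W₂₃ = 1 ⊗ W` on `H ⊗ H ⊗ H`, realised as `(H ⊗ H) ⊗ H`. -/
def leg23 (W : HTensor H H →L[ℂ] HTensor H H) :
    HTensor (HTensor H H) H →L[ℂ] HTensor (HTensor H H) H :=
  ((assoc H H H).symm : HTensor H (HTensor H H) →L[ℂ] HTensor (HTensor H H) H) ∘L
    opTensor 1 W ∘L (assoc H H H : HTensor (HTensor H H) H →L[ℂ] HTensor H (HTensor H H))

/-- Leg numbering: `W₁₃ = (1 ⊗ Σ)(W ⊗ 1)(1 ⊗ Σ)` on `H ⊗ H ⊗ H`. -/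
def leg13 (W : HTensor H H →L[ℂ] HTensor H H) :
    HTensor (HTensor H H) H →L[ℂ] HTensor (HTensor H H) H :=
  leg23 (flip H H : HTensor H H →L[ℂ] HTensor H H) ∘L leg12 W ∘L
    leg23 (flip H H : HTensor H H →L[ℂ] HTensor H H)

end HilbertTensor

section Predual

variable {H : Type u} [NormedAddCommGroup H] [InnerProductSpace ℂ H]

/-- The predual `B(H)_*`: the functionals `x ↦ ∑ₙ ⟨x ξₙ, ηₙ⟩` with `∑ₙ ‖ξₙ‖² < ∞` and
`∑ₙ ‖ηₙ‖² < ∞`. (Mathlib's inner product is linear in the second variable.) -/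
def predual (H : Type u) [NormedAddCommGroup H] [InnerProductSpace ℂ H] :
    Set ((H →L[ℂ] H) →L[ℂ] ℂ) :=
  {ω | ∃ ξ η : ℕ → H, (Summable fun n => ‖ξ n‖ ^ 2) ∧ (Summable fun n => ‖η n‖ ^ 2) ∧
    ∀ x : H →L[ℂ] H, HasSum (fun n => ⟪η n, x (ξ n)⟫_ℂ) (ω x)}

/-- The `σ`-weak topology on `B(H)`: the topology induced by the functionals in `B(H)_*`. -/
@[reducible] def sigmaWeak (H : Type u) [NormedAddCommGroup H] [InnerProductSpace ℂ H] :
    TopologicalSpace (H →L[ℂ] H) :=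
  TopologicalSpace.induced (fun x (ω : predual H) => (ω : (H →L[ℂ] H) →L[ℂ] ℂ) x) inferInstance

variable [CompleteSpace H] {E : Type v} [NormedAddCommGroup E] [InnerProductSpace ℂ E]
  [CompleteSpace E]

/-- For a continuous linear family `A : H → B(H, E)`, an operator `X` on `E` and a functional `ω`,
the operator `T` on `H` with `⟨T ξ, η⟩ = ω (A(η)* X A(ξ))` for all `ξ`, `η`. -/
def sliceAlong (A : H →L[ℂ] H →L[ℂ] E) (X : E →L[ℂ] E) (ω : (H →L[ℂ] H) →L[ℂ] ℂ) :
    H →L[ℂ] H :=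
  ContinuousLinearMap.adjoint (InnerProductSpace.continuousLinearMapOfBilin
    (((ContinuousLinearMap.compL ℂ H (H →L[ℂ] H) ℂ ω).comp
      (((ContinuousLinearMap.compL ℂ H (H →L[ℂ] E) (H →L[ℂ] H)).flip
        ((ContinuousLinearMap.compL ℂ H E E X).comp A)).comp
          (ContinuousLinearMap.compL ℂ H E H))).comp
      (((ContinuousLinearMap.adjoint (𝕜 := ℂ) (E := H) (F := E)).toContinuousLinearEquiv :
        (H →L[ℂ] E) →L⋆[ℂ] (E →L[ℂ] H)).comp A)))

theorem inner_sliceAlong (A : H →L[ℂ] H →L[ℂ] E) (X : E →L[ℂ] E) (ω : (H →L[ℂ] H) →L[ℂ] ℂ)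
    (ξ η : H) : ⟪η, sliceAlong A X ω ξ⟫_ℂ =
      ω (ContinuousLinearMap.adjoint (A η) ∘L X ∘L A ξ) := by
  rw [sliceAlong, ContinuousLinearMap.adjoint_inner_right,
    InnerProductSpace.continuousLinearMapOfBilin_apply]
  rfl

/-- The slice `(ι ⊗ ω)(X)`, determined by `⟨(ι ⊗ ω)(X) ξ, η⟩ = ω ((ω_{ξ,η} ⊗ ι)(X))`, where
`(ω_{ξ,η} ⊗ ι)(X) = L(η)* X L(ξ)` with `L(ξ) ζ = ξ ⊗ ζ`. -/
def sliceRight (ω : (H →L[ℂ] H) →L[ℂ] ℂ) (X : HTensor H H →L[ℂ] HTensor H H) : H →L[ℂ] H :=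
  sliceAlong (mkLeft H H) X ω

/-- The slice `(ω ⊗ ι)(X)`, determined by `⟨(ω ⊗ ι)(X) ξ, η⟩ = ω ((ι ⊗ ω_{ξ,η})(X))`, where
`(ι ⊗ ω_{ξ,η})(X) = R(η)* X R(ξ)` with `R(ξ) ζ = ζ ⊗ ξ`. -/
def sliceLeft (ω : (H →L[ℂ] H) →L[ℂ] ℂ) (X : HTensor H H →L[ℂ] HTensor H H) : H →L[ℂ] H :=
  sliceAlong (mkRight H H) X ω

end Predual

section VonNeumann

variable {H : Type u} [NormedAddCommGroup H] [InnerProductSpace ℂ H] [CompleteSpace H]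

/-- The von Neumann algebra generated by a set of operators: the smallest von Neumann algebra
containing it. -/
def generatedVN (S : Set (H →L[ℂ] H)) : VonNeumannAlgebra H where
  carrier := {x | ∀ N : VonNeumannAlgebra H, S ⊆ N → x ∈ N}
  mul_mem' ha hb N hN := mul_mem (ha N hN) (hb N hN)
  one_mem' N _ := one_mem N
  add_mem' ha hb N hN := add_mem (ha N hN) (hb N hN)
  zero_mem' N _ := zero_mem N
  algebraMap_mem' c N _ := N.toStarSubalgebra.algebraMap_mem c
  star_mem' ha N hN := star_mem (ha N hN)
  centralizer_centralizer' := by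
    refine Set.Subset.antisymm (fun x hx N hN => ?_) Set.subset_centralizer_centralizer
    have h := Set.centralizer_subset (Set.centralizer_subset
      (fun y (hy : ∀ N : VonNeumannAlgebra H, S ⊆ N → y ∈ N) => hy N hN)) hx
    rw [VonNeumannAlgebra.centralizer_centralizer] at h
    exact h

theorem subset_generatedVN (S : Set (H →L[ℂ] H)) : S ⊆ generatedVN S := fun _ hx _ hN => hN hx

/-- The von Neumann algebraic tensor product `M ⊗ M` on `H ⊗ H`, generated by the operators
`a ⊗ b` with `a, b ∈ M`. -/
def vnTensor (M : VonNeumannAlgebra H) : VonNeumannAlgebra (HTensor H H) :=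
  generatedVN {X | ∃ a ∈ M, ∃ b ∈ M, X = opTensor a b}

/-- The underlying `*`-algebra of a von Neumann algebra, as a type. -/
abbrev Alg (M : VonNeumannAlgebra H) : Type u := ↥M.toStarSubalgebra

/-- The elementary tensor `a ⊗ b` as an element of `M ⊗ M`. -/
def vnTmul {M : VonNeumannAlgebra H} (a b : Alg M) : Alg (vnTensor M) :=
  ⟨opTensor (a : H →L[ℂ] H) (b : H →L[ℂ] H),
    subset_generatedVN _ ⟨a, a.2, b, b.2, rfl⟩⟩

/-- The `σ`-weak topology on a von Neumann algebra. -/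
@[reducible] def sigmaWeakOn (M : VonNeumannAlgebra H) : TopologicalSpace (Alg M) :=
  (sigmaWeak H).induced Subtype.val

/-- `T = θ ⊗ θ` on `M ⊗ M`: the linear map `T` is `σ`-weakly continuous and satisfies
`T (a ⊗ b) = θ a ⊗ θ b` for all `a, b ∈ M` (at most one map `T` has this property). -/
structure IsTensorSquare {M : VonNeumannAlgebra H} (θ : Alg M → Alg M)
    (T : Alg (vnTensor M) →ₗ[ℂ] Alg (vnTensor M)) : Prop where
  continuous_sigmaWeak : Continuous[sigmaWeakOn (vnTensor M), sigmaWeakOn (vnTensor M)] T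
  map_vnTmul : ∀ a b : Alg M, T (vnTmul a b) = vnTmul (θ a) (θ b)

end VonNeumann

section Antilinear

/-- An antilinear operator `J` on a Hilbert space with `J = J*` and `J² = 1`; for antilinear
operators the adjoint is given by `⟨J ξ, η⟩ = ⟨J* η, ξ⟩`. -/
structure AntilinearInvolution (H : Type u) [NormedAddCommGroup H] [InnerProductSpace ℂ H] where
  toLinearMap : H →ₗ⋆[ℂ] H
  selfAdjoint : ∀ ξ η : H, ⟪toLinearMap ξ, η⟫_ℂ = ⟪toLinearMap η, ξ⟫_ℂ
  involutive : ∀ ξ : H, toLinearMap (toLinearMap ξ) = ξ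

namespace AntilinearInvolution

variable {H : Type u} [NormedAddCommGroup H] [InnerProductSpace ℂ H]
  {K : Type v} [NormedAddCommGroup K] [InnerProductSpace ℂ K]

theorem norm_map (J : AntilinearInvolution H) (ξ : H) : ‖J.toLinearMap ξ‖ = ‖ξ‖ := by
  have h := J.selfAdjoint ξ (J.toLinearMap ξ)
  rw [J.involutive, inner_self_eq_norm_sq_to_K, inner_self_eq_norm_sq_to_K] at h
  have h' : ‖J.toLinearMap ξ‖ ^ 2 = ‖ξ‖ ^ 2 := by exact_mod_cast h
  exact (sq_eq_sq₀ (norm_nonneg _) (norm_nonneg _)).1 h'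

/-- `J` as a continuous antilinear map. -/
def toCLM (J : AntilinearInvolution H) : H →L⋆[ℂ] H :=
  J.toLinearMap.mkContinuous 1 fun ξ => by rw [J.norm_map, one_mul]

/-- The operator `J x J`. -/
def conj (J : AntilinearInvolution H) (x : H →L[ℂ] H) : H →L[ℂ] H :=
  J.toCLM.comp (x.comp J.toCLM)

theorem conj_apply (J : AntilinearInvolution H) (x : H →L[ℂ] H) (ξ : H) :
    J.conj x ξ = J.toLinearMap (x (J.toLinearMap ξ)) := rfl

/-- `J ⊙ K` on the algebraic tensor product. -/
def algTensor (J : AntilinearInvolution H) (J' : AntilinearInvolution K) :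
    H ⊗[ℂ] K →ₗ⋆[ℂ] H ⊗[ℂ] K :=
  TensorProduct.map J.toLinearMap J'.toLinearMap

theorem inner_algTensor (J : AntilinearInvolution H) (J' : AntilinearInvolution K)
    (s t : H ⊗[ℂ] K) : ⟪J.algTensor J' s, t⟫_ℂ = ⟪J.algTensor J' t, s⟫_ℂ := by
  induction s using TensorProduct.induction_on with
  | zero => simp
  | add s₁ s₂ h₁ h₂ => rw [map_add, inner_add_left, inner_add_right, h₁, h₂]
  | tmul a b =>
    induction t using TensorProduct.induction_on with
    | zero => simp
    | add t₁ t₂ h₁ h₂ => rw [map_add, inner_add_left, inner_add_right, h₁, h₂]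
    | tmul c d => simp [algTensor, J.selfAdjoint a c, J'.selfAdjoint b d]

theorem algTensor_algTensor (J : AntilinearInvolution H) (J' : AntilinearInvolution K)
    (s : H ⊗[ℂ] K) : J.algTensor J' (J.algTensor J' s) = s := by
  induction s using TensorProduct.induction_on with
  | zero => simp
  | add s₁ s₂ h₁ h₂ => rw [map_add, map_add, h₁, h₂]
  | tmul a b => simp [algTensor, J.involutive a, J'.involutive b]

theorem norm_algTensor (J : AntilinearInvolution H) (J' : AntilinearInvolution K)
    (s : H ⊗[ℂ] K) : ‖J.algTensor J' s‖ = ‖s‖ := by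
  have h := inner_algTensor J J' s (J.algTensor J' s)
  rw [algTensor_algTensor] at h
  have h' : ‖J.algTensor J' s‖ ^ 2 = ‖s‖ ^ 2 := by
    rw [← inner_self_eq_norm_sq (𝕜 := ℂ) (J.algTensor J' s), ← inner_self_eq_norm_sq (𝕜 := ℂ) s]
    exact congrArg RCLike.re h
  exact (sq_eq_sq₀ (norm_nonneg _) (norm_nonneg _)).1 h'

/-- The continuous extension of `J ⊙ K` to the Hilbert space tensor product. -/
def extTensor (J : AntilinearInvolution H) (J' : AntilinearInvolution K) :
    HTensor H K →L⋆[ℂ] HTensor H K :=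
  ((emb H K).toLinearMap.comp (J.algTensor J')).extendOfNorm (emb H K).toLinearMap

theorem extTensor_emb (J : AntilinearInvolution H) (J' : AntilinearInvolution K)
    (s : H ⊗[ℂ] K) : J.extTensor J' (emb H K s) = emb H K (J.algTensor J' s) :=
  LinearMap.extendOfNorm_eq denseRange_emb ⟨1, fun s => by simp [norm_algTensor]⟩ s

/-- The antilinear operator `J ⊗ K`, `ξ ⊗ η ↦ J ξ ⊗ K η`, on the Hilbert space tensor product. -/
def tensor (J : AntilinearInvolution H) (J' : AntilinearInvolution K) :
    AntilinearInvolution (HTensor H K) where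
  toLinearMap := (J.extTensor J').toLinearMap
  selfAdjoint s t := by
    refine denseRange_emb.induction_on₂ (p := fun s t : HTensor H K =>
      ⟪J.extTensor J' s, t⟫_ℂ = ⟪J.extTensor J' t, s⟫_ℂ)
      (isClosed_eq (by fun_prop) (by fun_prop)) (fun a b => ?_) s t
    rw [extTensor_emb, extTensor_emb, LinearIsometry.inner_map_map, LinearIsometry.inner_map_map,
      inner_algTensor]
  involutive s := by
    refine denseRange_emb.induction_on (p := fun s : HTensor H K =>
      J.extTensor J' (J.extTensor J' s) = s) s (isClosed_eq (by fun_prop) (by fun_prop))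
      (fun a => ?_)
    rw [extTensor_emb, extTensor_emb, algTensor_algTensor]

theorem tensor_htmul (J : AntilinearInvolution H) (J' : AntilinearInvolution K) (ξ : H) (η : K) :
    (J.tensor J').toLinearMap (htmul ξ η) = htmul (J.toLinearMap ξ) (J'.toLinearMap η) :=
  extTensor_emb J J' _

end AntilinearInvolution

end Antilinear

section Multiplicative

variable {H : Type u} [NormedAddCommGroup H] [InnerProductSpace ℂ H] [CompleteSpace H]

/-- A multiplicative unitary: a unitary with the pentagon equation `W₁₂ W₁₃ W₂₃ = W₂₃ W₁₂`. -/
structure IsMultiplicativeUnitary (W : HTensor H H →L[ℂ] HTensor H H) : Prop where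
  mem_unitary : W ∈ unitary (HTensor H H →L[ℂ] HTensor H H)
  pentagon : leg12 W * leg13 W * leg23 W = leg23 W * leg12 W

/-- `S(W) = {(ι ⊗ ω)(W) | ω ∈ B(H)_*}`. -/
def rightSlices (W : HTensor H H →L[ℂ] HTensor H H) : Set (H →L[ℂ] H) :=
  {x | ∃ ω ∈ predual H, x = sliceRight ω W}

/-- `Ŝ(W) = {(ω ⊗ ι)(W) | ω ∈ B(H)_*}`. -/
def leftSlices (W : HTensor H H →L[ℂ] HTensor H H) : Set (H →L[ℂ] H) :=
  {x | ∃ ω ∈ predual H, x = sliceLeft ω W}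

/-- `M(W)`, the von Neumann algebra generated by `S(W)`. -/
def algM (W : HTensor H H →L[ℂ] HTensor H H) : VonNeumannAlgebra H :=
  generatedVN (rightSlices W)

/-- `M̂(W)`, the von Neumann algebra generated by `Ŝ(W)`. -/
def algMhat (W : HTensor H H →L[ℂ] HTensor H H) : VonNeumannAlgebra H :=
  generatedVN (leftSlices W)

/-- `W` is trim if the linear span of `{s ŝ* | s ∈ S, ŝ ∈ Ŝ}` is `σ`-weakly dense in `B(H)`. -/
def IsTrim (W : HTensor H H →L[ℂ] HTensor H H) : Prop :=
  @Dense (H →L[ℂ] H) (sigmaWeak H) (Submodule.span ℂ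
    {x : H →L[ℂ] H | ∃ s ∈ rightSlices W, ∃ t ∈ leftSlices W, x = s * star t} :
      Set (H →L[ℂ] H))

/-- The dual multiplicative unitary `Ŵ = Σ W* Σ`. -/
def dualUnitary (W : HTensor H H →L[ℂ] HTensor H H) : HTensor H H →L[ℂ] HTensor H H :=
  flipOp (star W)

/-- `W* (1 ⊗ m) W`, the formula for the comultiplication defined by `W`. -/
def comul (W : HTensor H H →L[ℂ] HTensor H H) (m : H →L[ℂ] H) :
    HTensor H H →L[ℂ] HTensor H H :=
  star W * opTensor 1 m * W

end Multiplicative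

/-- A quantum group frame `(W, J, Ĵ)` on a Hilbert space `H`. -/
structure QuantumGroupFrame (H : Type u) [NormedAddCommGroup H] [InnerProductSpace ℂ H]
    [CompleteSpace H] where
  W : HTensor H H →L[ℂ] HTensor H H
  J : AntilinearInvolution H
  Jhat : AntilinearInvolution H
  isMultiplicativeUnitary : IsMultiplicativeUnitary W
  isTrim : IsTrim W
  /-- `W* = (Ĵ ⊗ J) W (Ĵ ⊗ J)` -/
  star_W : star W = (Jhat.tensor J).conj W
  /-- `J M J ⊆ M'` -/
  conj_J_mem : ∀ m ∈ algM W, J.conj m ∈ (algM W).commutant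
  /-- `Ĵ M̂ Ĵ ⊆ M̂'` -/
  conj_Jhat_mem : ∀ m ∈ algMhat W, Jhat.conj m ∈ (algMhat W).commutant

namespace QuantumGroupFrame

variable {H : Type u} [NormedAddCommGroup H] [InnerProductSpace ℂ H] [CompleteSpace H]

/-- The von Neumann algebra `M` of the frame. -/
abbrev M (F : QuantumGroupFrame H) : VonNeumannAlgebra H := algM F.W

/-- The dual von Neumann algebra `M̂` of the frame. -/
abbrev Mhat (F : QuantumGroupFrame H) : VonNeumannAlgebra H := algMhat F.W

end QuantumGroupFrame

end QGF

end

/-!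
Let `W` be a multiplicative unitary with `W* = (A ⊗ B) W (A ⊗ B)` for antilinear involutions `A`
and `B`. The statement for `M` follows from these data alone, and the statement for `M̂` is the one
for the dual unitary `Σ W* Σ`: it is again multiplicative (`IsMultiplicativeUnitary.dual`), satisfies
the same condition with `A` and `B` exchanged (`star_dualUnitary`), and its algebra `M` is the
algebra `M̂` of `W` (`algMhat_eq`).

Von Neumann algebras are handled through commutants rather than by approximation in the `σ`-weak
topology. An operator `T` commutes with the slices `(ι ⊗ ω)(X)` if and only if `T ⊗ 1` commutes
with `X` (`commute_opTensor_one_iff`, `commute_rightSlices_iff`). Hence `x ∈ M` if and only if `x`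
commutes with every `T` for which `T ⊗ 1` and `T* ⊗ 1` commute with `W` (`mem_algM_iff`), and if
`Y₁₂` and its adjoint commute with `W₂₃`, then `Y` commutes with `1 ⊗ M`
(`commute_opTensor_one_of_leg`).

* `W* (1 ⊗ m) W ∈ M ⊗ M` (`IsMultiplicativeUnitary.comul_mem`): if `T` commutes with `M ⊗ M`, then
  `T₁₂` commutes with `W₁₃ W₂₃ = W₁₂* W₂₃ W₁₂`, so `(W T W*)₁₂` commutes with `W₂₃` and `W T W*`
  commutes with `1 ⊗ M`.
* `A M A = M` (`conj_mem_algM`), since `A ⊗ B` conjugates `W` to `W*`. So `R(m) = A m* A` is a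
  `*`-anti-automorphism, and `R ⊗ R` is `X ↦ (A ⊗ A) X* (A ⊗ A)`, which is `σ`-weakly continuous
  because composition with it preserves the predual (`comp_conjStar_mem_predual`).
* `Φ ∘ R = σ ∘ (R ⊗ R) ∘ Φ` (`IsMultiplicativeUnitary.comul_conj`) says that `1 ⊗ M` commutes with
  the unitary `U = W (A ⊗ A) Σ W* (A ⊗ A)`. By the criterion above it is enough that `U₁₂` commutes
  with `W₂₃` (`IsMultiplicativeUnitary.commute_leg12_conj_flip`), and conjugating by `A ⊗ A ⊗ B`
  reduces this to the pentagon equation.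
-/

namespace QGF

universe u v w

/-! ### Operators on Hilbert space tensor products -/

section Tensor

variable {H : Type u} [NormedAddCommGroup H] [InnerProductSpace ℂ H]
  {K : Type v} [NormedAddCommGroup K] [InnerProductSpace ℂ K]
  {L : Type w} [NormedAddCommGroup L] [InnerProductSpace ℂ L]

theorem ext_htmul {E : Type*} [NormedAddCommGroup E] [NormedSpace ℂ E] {τ : ℂ →+* ℂ}
    {f g : HTensor H K →SL[τ] E} (h : ∀ ξ η, f (htmul ξ η) = g (htmul ξ η)) : f = g := by
  refine DFunLike.coe_injective (denseRange_emb.equalizer f.continuous g.continuous ?_)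
  funext t
  induction t using TensorProduct.induction_on with
  | zero => simp
  | tmul ξ η => exact h ξ η
  | add s t hs ht =>
    simp only [Function.comp_apply, map_add] at hs ht ⊢
    rw [hs, ht]

theorem ext_htmul₃ {E : Type*} [NormedAddCommGroup E] [NormedSpace ℂ E] {τ : ℂ →+* ℂ}
    {f g : HTensor (HTensor H K) L →SL[τ] E}
    (h : ∀ ξ η ζ, f (htmul (htmul ξ η) ζ) = g (htmul (htmul ξ η) ζ)) : f = g := by
  refine ext_htmul fun z ζ => ?_
  have h' : f.comp (mkRight (HTensor H K) L ζ) = g.comp (mkRight (HTensor H K) L ζ) :=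
    ext_htmul fun ξ η => h ξ η ζ
  exact congrArg (· z) h'

theorem ext_inner_htmul {x y : HTensor H K} (h : ∀ a b, ⟪htmul a b, x⟫_ℂ = ⟪htmul a b, y⟫_ℂ) :
    x = y := by
  have h' : innerSL ℂ x = innerSL ℂ y := ext_htmul fun a b => by
    rw [innerSL_apply_apply, innerSL_apply_apply, ← inner_conj_symm x, ← inner_conj_symm y, h]
  exact ext_inner_right ℂ fun v => congrArg (· v) h'

theorem op_ext_inner_htmul {X Y : HTensor H K →L[ℂ] HTensor H K}
    (h : ∀ a b c d, ⟪htmul a b, X (htmul c d)⟫_ℂ = ⟪htmul a b, Y (htmul c d)⟫_ℂ) : X = Y :=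
  ext_htmul fun c d => ext_inner_htmul fun a b => h a b c d

theorem opTensor_mul (x x' : H →L[ℂ] H) (y y' : K →L[ℂ] K) :
    opTensor (x * x') (y * y') = opTensor x y * opTensor x' y' :=
  ext_htmul fun ξ η => by simp [opTensor_htmul]

@[simp]
theorem opTensor_one : opTensor (1 : H →L[ℂ] H) (1 : K →L[ℂ] K) = 1 :=
  ext_htmul fun ξ η => by simp [opTensor_htmul]

theorem opTensor_one_add (y y' : K →L[ℂ] K) :
    opTensor (1 : H →L[ℂ] H) (y + y') = opTensor 1 y + opTensor 1 y' :=
  ext_htmul fun ξ η => by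
    simp only [opTensor_htmul, add_apply]
    exact map_add (mkLeft H K _) _ _

theorem opTensor_one_smul (c : ℂ) (y : K →L[ℂ] K) :
    opTensor (1 : H →L[ℂ] H) (c • y) = c • opTensor 1 y :=
  ext_htmul fun ξ η => by
    simp only [opTensor_htmul, smul_apply]
    exact map_smul (mkLeft H K _) _ _

theorem opTensor_star [CompleteSpace H] [CompleteSpace K] (x : H →L[ℂ] H) (y : K →L[ℂ] K) :
    opTensor (star x) (star y) = star (opTensor x y) :=
  op_ext_inner_htmul fun a b c d => by
    simp only [ContinuousLinearMap.star_eq_adjoint, ContinuousLinearMap.adjoint_inner_right,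
      opTensor_htmul, inner_htmul]

theorem inner_flip_left (x : HTensor K H) (y : HTensor H K) :
    ⟪flip K H x, y⟫_ℂ = ⟪x, flip H K y⟫_ℂ := by
  have h : ∀ z : HTensor H K, flip K H (flip H K z) = z := fun z => by
    have h' : ((flip K H : HTensor K H →L[ℂ] HTensor H K).comp
        (flip H K : HTensor H K →L[ℂ] HTensor K H)) = 1 :=
      ext_htmul fun a b => by simp [flip_htmul]
    exact congrArg (· z) h'
  rw [← (flip K H).inner_map_map, h]

theorem flip_flip (z : HTensor H K) : flip K H (flip H K z) = z :=
  ext_inner_left ℂ fun v => by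
    rw [← inner_flip_left, (flip H K).inner_map_map]

/-- The flip `Σ` of `H ⊗ H` as a bounded operator. -/
noncomputable def flipCLM (H : Type u) [NormedAddCommGroup H] [InnerProductSpace ℂ H] :
    HTensor H H →L[ℂ] HTensor H H :=
  (flip H H : HTensor H H →L[ℂ] HTensor H H)

theorem flipCLM_htmul (ξ η : H) : flipCLM H (htmul ξ η) = htmul η ξ := flip_htmul ξ η

@[simp]
theorem flipCLM_mul_self : flipCLM H * flipCLM H = 1 :=
  ContinuousLinearMap.ext fun z => flip_flip z

@[simp]
theorem star_flipCLM [CompleteSpace H] : star (flipCLM H) = flipCLM H :=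
  ContinuousLinearMap.ext fun z => ext_inner_left ℂ fun v => by
    rw [ContinuousLinearMap.star_eq_adjoint, ContinuousLinearMap.adjoint_inner_right]
    exact inner_flip_left v z

theorem flipOp_eq (X : HTensor H H →L[ℂ] HTensor H H) :
    flipOp X = flipCLM H * X * flipCLM H := rfl

theorem flipOp_mul (X Y : HTensor H H →L[ℂ] HTensor H H) :
    flipOp (X * Y) = flipOp X * flipOp Y := by
  have h := flipCLM_mul_self (H := H)
  rw [flipOp_eq, flipOp_eq, flipOp_eq]
  calc _ = flipCLM H * X * 1 * Y * flipCLM H := by noncomm_ring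
    _ = _ := by rw [← h]; noncomm_ring

theorem flipOp_star [CompleteSpace H] (X : HTensor H H →L[ℂ] HTensor H H) :
    flipOp (star X) = star (flipOp X) := by
  simp [flipOp_eq, mul_assoc]

end Tensor

/-! ### Leg numbering -/

section Legs

variable {H : Type u} [NormedAddCommGroup H] [InnerProductSpace ℂ H]

theorem leg12_mul (X Y : HTensor H H →L[ℂ] HTensor H H) :
    leg12 (X * Y) = leg12 X * leg12 Y := by
  rw [leg12, leg12, leg12, ← opTensor_mul, one_mul]

theorem leg23_mul (X Y : HTensor H H →L[ℂ] HTensor H H) :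
    leg23 (X * Y) = leg23 X * leg23 Y := by
  ext v
  have h : opTensor (1 : H →L[ℂ] H) (X * Y) = opTensor 1 X * opTensor 1 Y := by
    rw [← opTensor_mul, one_mul]
  simp [leg23, h]

@[simp]
theorem leg12_one : leg12 (1 : HTensor H H →L[ℂ] HTensor H H) = 1 := opTensor_one

@[simp]
theorem leg23_one : leg23 (1 : HTensor H H →L[ℂ] HTensor H H) = 1 := by
  ext v
  simp [leg23]

theorem leg12_htmul (X : HTensor H H →L[ℂ] HTensor H H) (z : HTensor H H) (c : H) :
    leg12 X (htmul z c) = htmul (X z) c := opTensor_htmul X 1 z c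

theorem leg23_htmul (X : HTensor H H →L[ℂ] HTensor H H) (a b c : H) :
    leg23 X (htmul (htmul a b) c) = (assoc H H H).symm (htmul a (X (htmul b c))) := by
  simp [leg23, assoc_htmul, opTensor_htmul]

theorem leg23_flip_htmul (a b c : H) :
    leg23 (flipCLM H) (htmul (htmul a b) c) = htmul (htmul a c) b := by
  rw [leg23_htmul, flipCLM_htmul, ← assoc_htmul, LinearIsometryEquiv.symm_apply_apply]

theorem leg13_eq (X : HTensor H H →L[ℂ] HTensor H H) :
    leg13 X = leg23 (flipCLM H) * leg12 X * leg23 (flipCLM H) := rfl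

@[simp]
theorem leg12_flip_mul_self : leg12 (flipCLM H) * leg12 (flipCLM H) = 1 := by
  rw [← leg12_mul, flipCLM_mul_self, leg12_one]

@[simp]
theorem leg23_flip_mul_self : leg23 (flipCLM H) * leg23 (flipCLM H) = 1 := by
  rw [← leg23_mul, flipCLM_mul_self, leg23_one]

/-- The cyclic permutation `a ⊗ b ⊗ c ↦ b ⊗ c ⊗ a` carries `X₂₃` to `X₁₂`. -/
theorem cycle_mul_leg23 (X : HTensor H H →L[ℂ] HTensor H H) :
    leg23 (flipCLM H) * leg12 (flipCLM H) * leg23 X =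
      leg12 X * (leg23 (flipCLM H) * leg12 (flipCLM H)) := by
  have hY : ∀ a b c : H, (leg23 (flipCLM H) * leg12 (flipCLM H)) (htmul (htmul a b) c) =
      htmul (htmul b c) a := fun a b c => by
    rw [mul_apply_eq_comp, leg12_htmul, flipCLM_htmul, leg23_flip_htmul]
  have hZ : ∀ (a : H) (z : HTensor H H), (leg23 (flipCLM H) * leg12 (flipCLM H))
      ((assoc H H H).symm (htmul a z)) = htmul z a := fun a z => by
    have h : (leg23 (flipCLM H) * leg12 (flipCLM H)).comp
        (((assoc H H H).symm : HTensor H (HTensor H H) →L[ℂ] HTensor (HTensor H H) H).comp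
          (mkLeft H (HTensor H H) a)) = mkRight (HTensor H H) H a :=
      ext_htmul fun b c => by
        change (leg23 (flipCLM H) * leg12 (flipCLM H))
          ((assoc H H H).symm (htmul a (htmul b c))) = htmul (htmul b c) a
        rw [← assoc_htmul, LinearIsometryEquiv.symm_apply_apply, hY]
    exact congrArg (· z) h
  refine ext_htmul₃ fun a b c => ?_
  rw [mul_apply_eq_comp, leg23_htmul, hZ, mul_apply_eq_comp, hY,
    leg12_htmul]

theorem leg23_eq (X : HTensor H H →L[ℂ] HTensor H H) :
    leg23 X = leg12 (flipCLM H) * leg13 X * leg12 (flipCLM H) := by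
  have h := cycle_mul_leg23 X
  have hs := leg12_flip_mul_self (H := H)
  have ht := leg23_flip_mul_self (H := H)
  rw [leg13_eq]
  generalize leg12 (flipCLM H) = s at *
  generalize leg23 (flipCLM H) = t at *
  calc leg23 X = (s * (t * t) * s) * leg23 X := by rw [ht, mul_one, hs, one_mul]
    _ = s * t * (t * s * leg23 X) := by noncomm_ring
    _ = _ := by rw [h]; noncomm_ring

theorem leg13_eq' (X : HTensor H H →L[ℂ] HTensor H H) :
    leg13 X = leg12 (flipCLM H) * leg23 X * leg12 (flipCLM H) := by
  rw [leg23_eq]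
  have hs := leg12_flip_mul_self (H := H)
  generalize leg12 (flipCLM H) = s at *
  calc leg13 X = (s * s) * leg13 X * (s * s) := by rw [hs, one_mul, mul_one]
    _ = _ := by noncomm_ring

theorem leg12_flipOp (X : HTensor H H →L[ℂ] HTensor H H) :
    leg12 (flipOp X) = leg12 (flipCLM H) * leg12 X * leg12 (flipCLM H) := by
  rw [flipOp_eq, leg12_mul, leg12_mul]

theorem leg23_flipOp (X : HTensor H H →L[ℂ] HTensor H H) :
    leg23 (flipOp X) = leg23 (flipCLM H) * leg23 X * leg23 (flipCLM H) := by
  rw [flipOp_eq, leg23_mul, leg23_mul]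

theorem IsMultiplicativeUnitary.leg12_conj_leg23 {W : HTensor H H →L[ℂ] HTensor H H}
    (hW : IsMultiplicativeUnitary W) : leg12 (star W) * leg23 W * leg12 W = leg13 W * leg23 W := by
  rw [mul_assoc, ← hW.pentagon, ← mul_assoc, ← mul_assoc, ← leg12_mul,
    (Unitary.mem_iff.1 hW.mem_unitary).1, leg12_one, one_mul]

variable [CompleteSpace H]

theorem leg12_star (X : HTensor H H →L[ℂ] HTensor H H) : leg12 (star X) = star (leg12 X) := by
  rw [leg12, leg12, ← opTensor_star, star_one]

theorem leg23_star (X : HTensor H H →L[ℂ] HTensor H H) : leg23 (star X) = star (leg23 X) := by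
  have h : ∀ v, opTensor (1 : H →L[ℂ] H) (star X) v =
      ContinuousLinearMap.adjoint (opTensor 1 X) v := fun v => by
    rw [← ContinuousLinearMap.star_eq_adjoint, ← opTensor_star, star_one]
  refine ContinuousLinearMap.ext fun v => ext_inner_left ℂ fun z => ?_
  rw [ContinuousLinearMap.star_eq_adjoint (leg23 X), ContinuousLinearMap.adjoint_inner_right]
  simp only [leg23, ContinuousLinearMap.comp_apply]
  refine ((assoc H H H).inner_map_map _ _).symm.trans ?_
  refine Eq.trans ?_ ((assoc H H H).inner_map_map _ _)
  simp [h, ContinuousLinearMap.adjoint_inner_right]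

theorem leg13_star (X : HTensor H H →L[ℂ] HTensor H H) : leg13 (star X) = star (leg13 X) := by
  rw [leg13_eq, leg13_eq, star_mul, star_mul, ← leg23_star, ← leg12_star, star_flipCLM, mul_assoc]

/-- The dual of a multiplicative unitary is multiplicative: conjugation by
`Σ₁₂ Σ₂₃ Σ₁₂`, the exchange of the first and third legs, turns the adjoint of the pentagon equation
for `W` into the pentagon equation for `Σ W* Σ`. -/
theorem IsMultiplicativeUnitary.dual {W : HTensor H H →L[ℂ] HTensor H H}
    (hW : IsMultiplicativeUnitary W) : IsMultiplicativeUnitary (dualUnitary W) where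
  mem_unitary := by
    obtain ⟨h1, h2⟩ := Unitary.mem_iff.1 hW.mem_unitary
    rw [dualUnitary, Unitary.mem_iff, ← flipOp_star, star_star, ← flipOp_mul, ← flipOp_mul, h1, h2]
    simp [flipOp_eq]
  pentagon := by
    have hp := congrArg star hW.pentagon
    simp only [star_mul, ← leg12_star, ← leg13_star, ← leg23_star] at hp
    unfold dualUnitary
    generalize star W = V at *
    have e12 := leg12_flipOp V
    have e23 := leg23_flipOp V
    have e13 := leg13_eq (flipOp V)
    have f := leg23_eq V
    have g := leg13_eq V
    have hs := leg12_flip_mul_self (H := H)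
    have ht := leg23_flip_mul_self (H := H)
    have k12 : leg12 (flipOp V) = (leg12 (flipCLM H) * leg23 (flipCLM H) * leg12 (flipCLM H)) *
        leg23 V * (leg12 (flipCLM H) * leg23 (flipCLM H) * leg12 (flipCLM H)) := by
      rw [e12, f, g]
      generalize leg12 (flipCLM H) = s at *
      generalize leg23 (flipCLM H) = t at *
      symm
      calc _ = s * t * (s * s) * t * leg12 V * t * (s * s) * t * s := by noncomm_ring
        _ = s * (t * t) * leg12 V * (t * t) * s := by rw [hs]; noncomm_ring
        _ = _ := by rw [ht, mul_one, mul_one]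
    have k23 : leg23 (flipOp V) = (leg12 (flipCLM H) * leg23 (flipCLM H) * leg12 (flipCLM H)) *
        leg12 V * (leg12 (flipCLM H) * leg23 (flipCLM H) * leg12 (flipCLM H)) := by
      rw [leg23_eq, e13, e12]
      noncomm_ring
    have k13 : leg13 (flipOp V) = (leg12 (flipCLM H) * leg23 (flipCLM H) * leg12 (flipCLM H)) *
        leg13 V * (leg12 (flipCLM H) * leg23 (flipCLM H) * leg12 (flipCLM H)) := by
      rw [leg13_eq' (flipOp V), e23, f]
      noncomm_ring
    rw [k12, k13, k23]
    have hθ : (leg12 (flipCLM H) * leg23 (flipCLM H) * leg12 (flipCLM H)) *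
        (leg12 (flipCLM H) * leg23 (flipCLM H) * leg12 (flipCLM H)) = 1 := by
      generalize leg12 (flipCLM H) = s at *
      generalize leg23 (flipCLM H) = t at *
      calc _ = s * t * (s * s) * t * s := by noncomm_ring
        _ = s * (t * t) * s := by rw [hs]; noncomm_ring
        _ = 1 := by rw [ht, mul_one, hs]
    generalize leg12 (flipCLM H) * leg23 (flipCLM H) * leg12 (flipCLM H) = θ at *
    calc _ = θ * leg23 V * (θ * θ) * leg13 V * (θ * θ) * leg12 V * θ := by noncomm_ring
      _ = θ * (leg23 V * (leg13 V * leg12 V)) * θ := by rw [hθ]; noncomm_ring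
      _ = θ * leg12 V * 1 * leg23 V * θ := by rw [hp]; noncomm_ring
      _ = _ := by rw [← hθ]; noncomm_ring

end Legs

/-! ### Vector slices and commutants -/

section Slices

variable {H : Type u} [NormedAddCommGroup H] [InnerProductSpace ℂ H]
  {K : Type v} [NormedAddCommGroup K] [InnerProductSpace ℂ K]

/-- The slice `(ι ⊗ ω)(X)` on `H` for the vector functional `ω = ⟪a, · b⟫` on `B(K)`. -/
noncomputable def vecSliceRight [CompleteSpace H] (X : HTensor H K →L[ℂ] HTensor H K) (a b : K) :
    H →L[ℂ] H :=
  ContinuousLinearMap.adjoint (mkRight H K a) ∘L X ∘L mkRight H K b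

/-- The slice `(ω ⊗ ι)(X)` on `K` for the vector functional `ω = ⟪a, · b⟫` on `B(H)`. -/
noncomputable def vecSliceLeft [CompleteSpace K] (X : HTensor H K →L[ℂ] HTensor H K) (a b : H) :
    K →L[ℂ] K :=
  ContinuousLinearMap.adjoint (mkLeft H K a) ∘L X ∘L mkLeft H K b

theorem inner_vecSliceRight [CompleteSpace H] (X : HTensor H K →L[ℂ] HTensor H K)
    (a b : K) (c d : H) :
    ⟪c, vecSliceRight X a b d⟫_ℂ = ⟪htmul c a, X (htmul d b)⟫_ℂ := by
  simp only [vecSliceRight, ContinuousLinearMap.comp_apply,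
    ContinuousLinearMap.adjoint_inner_right, mkRight_apply]

theorem inner_vecSliceLeft [CompleteSpace K] (X : HTensor H K →L[ℂ] HTensor H K)
    (a b : H) (c d : K) :
    ⟪c, vecSliceLeft X a b d⟫_ℂ = ⟪htmul a c, X (htmul b d)⟫_ℂ := by
  simp only [vecSliceLeft, ContinuousLinearMap.comp_apply,
    ContinuousLinearMap.adjoint_inner_right, mkLeft_apply]

theorem vectorFunctional_mem_predual (a b : H) :
    ((innerSL ℂ a).comp (ContinuousLinearMap.apply ℂ H b) : (H →L[ℂ] H) →L[ℂ] ℂ) ∈ predual H := by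
  refine ⟨fun n => if n = 0 then b else 0, fun n => if n = 0 then a else 0, ?_, ?_, fun x => ?_⟩
  · exact summable_of_ne_finset_zero (s := {0}) fun n hn => by simp_all
  · exact summable_of_ne_finset_zero (s := {0}) fun n hn => by simp_all
  · convert hasSum_single 0 fun n hn => ?_
    · simp
    · simp [hn]

theorem star_vecSliceLeft [CompleteSpace K] (X : HTensor H K →L[ℂ] HTensor H K)
    (a b : H) :
    star (vecSliceLeft X a b) = vecSliceLeft (star X) b a := by
  refine ContinuousLinearMap.ext fun d => ext_inner_left ℂ fun c => ?_
  rw [inner_vecSliceLeft, ContinuousLinearMap.star_eq_adjoint,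
    ContinuousLinearMap.star_eq_adjoint, ContinuousLinearMap.adjoint_inner_right,
    ContinuousLinearMap.adjoint_inner_right, ← inner_conj_symm, inner_vecSliceLeft,
    inner_conj_symm]

variable [CompleteSpace H] [CompleteSpace K]

theorem inner_opTensor_left (x : H →L[ℂ] H) (y : K →L[ℂ] K) (a : H) (b : K) (z : HTensor H K) :
    ⟪htmul a b, opTensor x y z⟫_ℂ = ⟪htmul (star x a) (star y b), z⟫_ℂ := by
  rw [← opTensor_htmul, opTensor_star, ContinuousLinearMap.star_eq_adjoint,
    ContinuousLinearMap.adjoint_inner_left]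

/-- `T ⊗ 1` commutes with `X` if and only if `T` commutes with the right slices of `X`. -/
theorem commute_opTensor_one_iff (T : H →L[ℂ] H) (X : HTensor H K →L[ℂ] HTensor H K) :
    Commute (opTensor T 1) X ↔ ∀ a b, Commute T (vecSliceRight X a b) := by
  have key : ∀ a b c d,
      ⟪htmul c a, (opTensor T 1 * X : HTensor H K →L[ℂ] HTensor H K) (htmul d b)⟫_ℂ =
        ⟪c, (T * vecSliceRight X a b) d⟫_ℂ ∧
      ⟪htmul c a, (X * opTensor T 1 : HTensor H K →L[ℂ] HTensor H K) (htmul d b)⟫_ℂ =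
        ⟪c, (vecSliceRight X a b * T) d⟫_ℂ := by
    intro a b c d
    constructor
    · rw [mul_apply_eq_comp, inner_opTensor_left, star_one, mul_apply_eq_comp,
        ← ContinuousLinearMap.adjoint_inner_left T, inner_vecSliceRight]
      rfl
    · rw [mul_apply_eq_comp, opTensor_htmul, mul_apply_eq_comp, inner_vecSliceRight]
      rfl
  constructor
  · intro h a b
    refine ContinuousLinearMap.ext fun d => ext_inner_left ℂ fun c => ?_
    rw [← (key a b c d).1, ← (key a b c d).2, h.eq]
  · intro h
    refine op_ext_inner_htmul fun c a d b => ?_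
    rw [(key a b c d).1, (key a b c d).2, (h a b).eq]

/-- `1 ⊗ T` commutes with `X` if and only if `T` commutes with the left slices of `X`. -/
theorem commute_opTensor_one_left_iff (T : K →L[ℂ] K) (X : HTensor H K →L[ℂ] HTensor H K) :
    Commute (opTensor 1 T) X ↔ ∀ a b, Commute T (vecSliceLeft X a b) := by
  have key : ∀ a b c d,
      ⟪htmul a c, (opTensor 1 T * X : HTensor H K →L[ℂ] HTensor H K) (htmul b d)⟫_ℂ =
        ⟪c, (T * vecSliceLeft X a b) d⟫_ℂ ∧
      ⟪htmul a c, (X * opTensor 1 T : HTensor H K →L[ℂ] HTensor H K) (htmul b d)⟫_ℂ =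
        ⟪c, (vecSliceLeft X a b * T) d⟫_ℂ := by
    intro a b c d
    constructor
    · rw [mul_apply_eq_comp, inner_opTensor_left, star_one, mul_apply_eq_comp,
        ← ContinuousLinearMap.adjoint_inner_left T, inner_vecSliceLeft]
      rfl
    · rw [mul_apply_eq_comp, opTensor_htmul, mul_apply_eq_comp, inner_vecSliceLeft]
      rfl
  constructor
  · intro h a b
    refine ContinuousLinearMap.ext fun d => ext_inner_left ℂ fun c => ?_
    rw [← (key a b c d).1, ← (key a b c d).2, h.eq]
  · intro h
    refine op_ext_inner_htmul fun a c b d => ?_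
    rw [(key a b c d).1, (key a b c d).2, (h a b).eq]

theorem vecSliceRight_leg23 (X : HTensor H H →L[ℂ] HTensor H H) (a b : H) :
    vecSliceRight (leg23 X) a b = opTensor 1 (vecSliceRight X a b) := by
  refine op_ext_inner_htmul fun c c' d d' => ?_
  rw [inner_vecSliceRight, leg23_htmul, opTensor_htmul, inner_htmul, inner_vecSliceRight,
    ← (assoc H H H).inner_map_map, LinearIsometryEquiv.apply_symm_apply, assoc_htmul, inner_htmul]
  rfl

theorem vecSliceRight_leg13 (X : HTensor H H →L[ℂ] HTensor H H) (a b : H) :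
    vecSliceRight (leg13 X) a b = opTensor (vecSliceRight X a b) 1 := by
  refine op_ext_inner_htmul fun c c' d d' => ?_
  rw [inner_vecSliceRight, leg13_eq, mul_apply_eq_comp, leg23_flip_htmul, mul_apply_eq_comp,
    leg12_htmul, ← ContinuousLinearMap.adjoint_inner_left, ← ContinuousLinearMap.star_eq_adjoint,
    ← leg23_star, star_flipCLM, leg23_flip_htmul, inner_htmul, opTensor_htmul, inner_htmul,
    inner_vecSliceRight]
  rfl

/-- `Y₁₂` and `X₂₃` commute if and only if the left slices of `Y`, placed in the first leg,
commute with `X`. -/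
theorem commute_leg12_leg23_iff (Y X : HTensor H H →L[ℂ] HTensor H H) :
    Commute (leg12 Y) (leg23 X) ↔ ∀ a b, Commute (opTensor (vecSliceLeft Y a b) 1) X := by
  simp only [leg12, commute_opTensor_one_iff, vecSliceRight_leg23]
  constructor
  · intro h a b c d
    exact ((commute_opTensor_one_left_iff _ _).1 (h c d).symm a b).symm
  · intro h c d
    exact ((commute_opTensor_one_left_iff _ _).2 fun a b => (h a b c d).symm).symm

theorem vecSliceRight_mem_rightSlices (W : HTensor H H →L[ℂ] HTensor H H) (a b : H) :
    vecSliceRight W a b ∈ rightSlices W := by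
  refine ⟨_, vectorFunctional_mem_predual a b, ?_⟩
  refine ContinuousLinearMap.ext fun d => ext_inner_left ℂ fun c => ?_
  rw [inner_vecSliceRight, sliceRight, inner_sliceAlong]
  simp [ContinuousLinearMap.adjoint_inner_right, mkLeft_apply]

/-- Slices by arbitrary normal functionals commute with whatever the vector slices commute with. -/
theorem commute_rightSlices_iff (T : H →L[ℂ] H) (W : HTensor H H →L[ℂ] HTensor H H) :
    (∀ s ∈ rightSlices W, Commute T s) ↔ Commute (opTensor T 1) W := by
  refine ⟨fun h => (commute_opTensor_one_iff T W).2 fun a b =>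
    h _ (vecSliceRight_mem_rightSlices W a b), ?_⟩
  rintro h s ⟨ω, ⟨ξ, η, -, -, hω⟩, rfl⟩
  refine ContinuousLinearMap.ext fun d => ext_inner_left ℂ fun c => ?_
  rw [mul_apply_eq_comp, mul_apply_eq_comp, ← ContinuousLinearMap.adjoint_inner_left T,
    sliceRight, inner_sliceAlong, inner_sliceAlong]
  refine (hω _).unique ((congrArg (HasSum · _) (funext fun n => ?_)).mp (hω _))
  simp only [ContinuousLinearMap.comp_apply, ContinuousLinearMap.adjoint_inner_right, mkLeft_apply]
  have h' := congrArg (fun Z => ⟪htmul c (η n), Z (htmul d (ξ n))⟫_ℂ) h.eq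
  simp only [mul_apply_eq_comp, inner_opTensor_left, star_one, opTensor_htmul] at h'
  exact h'.symm

theorem leftSlices_eq (W : HTensor H H →L[ℂ] HTensor H H) :
    leftSlices W = rightSlices (flipOp W) := by
  have h : ∀ ω, sliceLeft ω W = sliceRight ω (flipOp W) := fun ω => by
    refine ContinuousLinearMap.ext fun d => ext_inner_left ℂ fun c => ?_
    rw [sliceLeft, sliceRight, inner_sliceAlong, inner_sliceAlong]
    congr 1
    refine ContinuousLinearMap.ext fun e => ext_inner_left ℂ fun f => ?_
    simp only [ContinuousLinearMap.comp_apply, ContinuousLinearMap.adjoint_inner_right,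
      mkLeft_apply, mkRight_apply, flipOp_eq, mul_apply_eq_comp, flipCLM_htmul]
    have h := inner_flip_left (htmul c f) (W (htmul e d))
    rwa [flip_htmul] at h
  simp only [leftSlices, rightSlices, h]

end Slices

section VonNeumann

variable {H : Type u} [NormedAddCommGroup H] [InnerProductSpace ℂ H] [CompleteSpace H]

/-- The bicommutant description of the von Neumann algebra generated by `S`. -/
theorem mem_generatedVN_iff (S : Set (H →L[ℂ] H)) (x : H →L[ℂ] H) :
    x ∈ generatedVN S ↔
      ∀ T, (∀ s ∈ S, Commute T s) → (∀ s ∈ S, Commute (star T) s) → Commute T x := by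
  constructor
  · intro hx T h1 h2
    let A : StarSubalgebra ℂ (H →L[ℂ] H) := StarSubalgebra.centralizer ℂ {T}
    let N : VonNeumannAlgebra H :=
      { A with
        centralizer_centralizer' := by
          change Set.centralizer (Set.centralizer (A : Set (H →L[ℂ] H))) = (A : Set (H →L[ℂ] H))
          simp only [A, StarSubalgebra.coe_centralizer]
          exact Set.centralizer_centralizer_centralizer _ }
    have hN : S ⊆ N := fun s hs => by
      change s ∈ StarSubalgebra.centralizer ℂ {T}
      rw [StarSubalgebra.mem_centralizer_iff]
      rintro g rfl
      exact ⟨h1 s hs, h2 s hs⟩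
    have h : x ∈ StarSubalgebra.centralizer ℂ {T} := hx N hN
    rw [StarSubalgebra.mem_centralizer_iff] at h
    exact (h T rfl).1
  · intro h N hN
    rw [← N.commutant_commutant, VonNeumannAlgebra.mem_commutant_iff]
    intro T hT
    have hT' := star_mem hT
    rw [VonNeumannAlgebra.mem_commutant_iff] at hT hT'
    exact h T (fun s hs => (hT s (hN hs)).symm) fun s hs => (hT' s (hN hs)).symm

theorem mem_algM_iff (W : HTensor H H →L[ℂ] HTensor H H) (x : H →L[ℂ] H) :
    x ∈ algM W ↔ ∀ T, Commute (opTensor T 1) W → Commute (opTensor (star T) 1) W →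
      Commute T x := by
  rw [algM, mem_generatedVN_iff]
  simp only [commute_rightSlices_iff]

theorem vecSliceRight_mem_algM (W : HTensor H H →L[ℂ] HTensor H H) (a b : H) :
    vecSliceRight W a b ∈ algM W :=
  subset_generatedVN _ (vecSliceRight_mem_rightSlices W a b)

/-- The von Neumann algebra `M̂` of `W` is the von Neumann algebra `M` of the dual of `W`. -/
theorem algMhat_eq (W : HTensor H H →L[ℂ] HTensor H H) : algMhat W = algM (dualUnitary W) := by
  have h : ∀ T : H →L[ℂ] H,
      Commute (opTensor T 1) (dualUnitary W) ↔ Commute (opTensor (star T) 1) (flipOp W) := by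
    intro T
    rw [dualUnitary, flipOp_star, ← commute_star_comm, ← opTensor_star, star_one]
  refine SetLike.ext fun x => ?_
  rw [mem_algM_iff, algMhat, leftSlices_eq, mem_generatedVN_iff]
  simp only [commute_rightSlices_iff, h, star_star]
  exact forall_congr' fun T => forall_comm

/-- If `Y₁₂` and its adjoint commute with `W₂₃`, then `Y` commutes with `1 ⊗ M`. -/
theorem commute_opTensor_one_of_leg {W Y : HTensor H H →L[ℂ] HTensor H H}
    (h : Commute (leg12 Y) (leg23 W)) (h' : Commute (leg12 (star Y)) (leg23 W))
    {m : H →L[ℂ] H} (hm : m ∈ algM W) : Commute Y (opTensor 1 m) := by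
  refine ((commute_opTensor_one_left_iff m Y).2 fun a b => Commute.symm ?_).symm
  refine (mem_algM_iff W m).1 hm _ ((commute_leg12_leg23_iff Y W).1 h a b) ?_
  rw [star_vecSliceLeft]
  exact (commute_leg12_leg23_iff _ W).1 h' b a

/-! ### The comultiplication -/

/-- `W* (1 ⊗ m) W` belongs to `M ⊗ M`: an operator `T` commuting with `M ⊗ M` satisfies that `T₁₂`
commutes with `W₁₃ W₂₃ = W₁₂* W₂₃ W₁₂`, so that `W T W*` commutes with `1 ⊗ M`. -/
theorem IsMultiplicativeUnitary.comul_mem {W : HTensor H H →L[ℂ] HTensor H H}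
    (hW : IsMultiplicativeUnitary W) {m : H →L[ℂ] H} (hm : m ∈ algM W) :
    comul W m ∈ vnTensor (algM W) := by
  obtain ⟨hW1, hW2⟩ := Unitary.mem_iff.1 hW.mem_unitary
  have key : ∀ T : HTensor H H →L[ℂ] HTensor H H,
      (∀ s ∈ {X | ∃ a ∈ algM W, ∃ b ∈ algM W, X = opTensor a b}, Commute T s) →
      Commute (leg12 (W * T * star W)) (leg23 W) := by
    intro T hT
    have h13 : Commute (leg12 T) (leg13 W) := by
      refine (commute_opTensor_one_iff _ _).2 fun a b => ?_
      rw [vecSliceRight_leg13]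
      exact hT _ ⟨_, vecSliceRight_mem_algM W a b, 1, one_mem _, rfl⟩
    have h23 : Commute (leg12 T) (leg23 W) := by
      refine (commute_opTensor_one_iff _ _).2 fun a b => ?_
      rw [vecSliceRight_leg23]
      exact hT _ ⟨1, one_mem _, _, vecSliceRight_mem_algM W a b, rfl⟩
    have h := (h13.mul_right h23).eq
    rw [← hW.leg12_conj_leg23] at h
    have e1 : leg12 (star W) * leg12 W = 1 := by rw [← leg12_mul, hW1, leg12_one]
    have e2 : leg12 W * leg12 (star W) = 1 := by rw [← leg12_mul, hW2, leg12_one]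
    rw [Commute, SemiconjBy, leg12_mul, leg12_mul]
    generalize leg12 W = w at *
    generalize leg12 (star W) = w' at *
    calc w * leg12 T * w' * leg23 W
        = w * leg12 T * w' * leg23 W * (w * w') := by rw [e2, mul_one]
      _ = w * (leg12 T * (w' * leg23 W * w)) * w' := by noncomm_ring
      _ = (w * w') * leg23 W * (w * leg12 T * w') := by rw [h]; noncomm_ring
      _ = _ := by rw [e2, one_mul]
  rw [vnTensor, mem_generatedVN_iff]
  intro T hT hT'
  have h := (commute_opTensor_one_of_leg (key T hT)
    (by rw [star_mul, star_mul, star_star, ← mul_assoc]; exact key _ hT') hm).eq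
  rw [comul, Commute, SemiconjBy]
  calc T * (star W * opTensor 1 m * W)
      = (star W * W) * T * star W * opTensor 1 m * W := by rw [hW1]; noncomm_ring
    _ = star W * (W * T * star W * opTensor 1 m) * W := by noncomm_ring
    _ = star W * opTensor 1 m * W * T * (star W * W) := by rw [h]; noncomm_ring
    _ = _ := by rw [hW1, mul_one]

/-- The comultiplication `m ↦ W* (1 ⊗ m) W` as a unital `*`-homomorphism `M → M ⊗ M`. -/
noncomputable def comulHom {W : HTensor H H →L[ℂ] HTensor H H} (hW : IsMultiplicativeUnitary W) :
    Alg (algM W) →⋆ₐ[ℂ] Alg (vnTensor (algM W)) where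
  toFun m := ⟨comul W m, hW.comul_mem m.2⟩
  map_one' := Subtype.ext <| by
    simp [comul, (Unitary.mem_iff.1 hW.mem_unitary).1]
  map_mul' x y := Subtype.ext <| by
    have h : opTensor (1 : H →L[ℂ] H) ((x : H →L[ℂ] H) * (y : H →L[ℂ] H)) =
      opTensor 1 (x : H →L[ℂ] H) * (W * star W) * opTensor 1 (y : H →L[ℂ] H) := by
      rw [(Unitary.mem_iff.1 hW.mem_unitary).2, mul_one, ← opTensor_mul, one_mul]
    change star W * opTensor 1 ((x : H →L[ℂ] H) * (y : H →L[ℂ] H)) * W =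
      (star W * opTensor 1 (x : H →L[ℂ] H) * W) * (star W * opTensor 1 (y : H →L[ℂ] H) * W)
    rw [h]
    noncomm_ring
  map_zero' := Subtype.ext <| by
    have h := opTensor_one_smul (H := H) 0 (0 : H →L[ℂ] H)
    rw [zero_smul, zero_smul] at h
    simp [comul, h]
  map_add' x y := Subtype.ext <| by
    simp [comul, opTensor_one_add, mul_add, add_mul]
  commutes' c := Subtype.ext <| by
    have h : opTensor (1 : H →L[ℂ] H) (algebraMap ℂ (H →L[ℂ] H) c) = c • 1 := by
      rw [Algebra.algebraMap_eq_smul_one, opTensor_one_smul, opTensor_one]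
    change star W * opTensor 1 (algebraMap ℂ (H →L[ℂ] H) c) * W =
      algebraMap ℂ (HTensor H H →L[ℂ] HTensor H H) c
    rw [h, Algebra.algebraMap_eq_smul_one, mul_smul_comm, smul_mul_assoc, mul_one,
      (Unitary.mem_iff.1 hW.mem_unitary).1]
  map_star' x := Subtype.ext <| by
    change star W * opTensor 1 (star (x : H →L[ℂ] H)) * W =
      star (star W * opTensor 1 (x : H →L[ℂ] H) * W)
    rw [star_mul, star_mul, star_star, ← opTensor_star, star_one, mul_assoc]

end VonNeumann

/-! ### Conjugation by antilinear involutions -/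

namespace AntilinearInvolution

section Conj

variable {H : Type u} [NormedAddCommGroup H] [InnerProductSpace ℂ H]
  {K : Type v} [NormedAddCommGroup K] [InnerProductSpace ℂ K]

theorem conj_conj (J : AntilinearInvolution H) (x : H →L[ℂ] H) : J.conj (J.conj x) = x :=
  ContinuousLinearMap.ext fun ξ => by simp only [conj_apply, J.involutive]

theorem conj_mul (J : AntilinearInvolution H) (x y : H →L[ℂ] H) :
    J.conj (x * y) = J.conj x * J.conj y :=
  ContinuousLinearMap.ext fun ξ => by simp only [mul_apply_eq_comp, conj_apply, J.involutive]

theorem conj_add (J : AntilinearInvolution H) (x y : H →L[ℂ] H) :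
    J.conj (x + y) = J.conj x + J.conj y :=
  ContinuousLinearMap.ext fun ξ => by simp only [add_apply, conj_apply, map_add]

theorem conj_smul (J : AntilinearInvolution H) (c : ℂ) (x : H →L[ℂ] H) :
    J.conj (c • x) = star c • J.conj x :=
  ContinuousLinearMap.ext fun ξ => by
    simp only [smul_apply, conj_apply, LinearMap.map_smulₛₗ]
    rfl

theorem norm_conj_le (J : AntilinearInvolution H) (x : H →L[ℂ] H) : ‖J.conj x‖ ≤ ‖x‖ :=
  ContinuousLinearMap.opNorm_le_bound _ (norm_nonneg _) fun ξ => by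
    rw [conj_apply, J.norm_map]
    exact (x.le_opNorm _).trans_eq (by rw [J.norm_map])

theorem conj_star [CompleteSpace H] (J : AntilinearInvolution H) (x : H →L[ℂ] H) :
    J.conj (star x) = star (J.conj x) := by
  refine ContinuousLinearMap.ext fun b => ext_inner_left ℂ fun a => ?_
  rw [ContinuousLinearMap.star_eq_adjoint (J.conj x), ContinuousLinearMap.adjoint_inner_right,
    conj_apply, conj_apply, J.selfAdjoint, ← inner_conj_symm, J.selfAdjoint, inner_conj_symm,
    ContinuousLinearMap.star_eq_adjoint, ContinuousLinearMap.adjoint_inner_left]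

theorem commute_conj (J : AntilinearInvolution H) {x y : H →L[ℂ] H} (h : Commute x (J.conj y)) :
    Commute (J.conj x) y := by
  have h' := congrArg J.conj h.eq
  rwa [conj_mul, conj_mul, conj_conj] at h'

theorem conj_opTensor (J : AntilinearInvolution H) (J' : AntilinearInvolution K)
    (x : H →L[ℂ] H) (y : K →L[ℂ] K) :
    (J.tensor J').conj (opTensor x y) = opTensor (J.conj x) (J'.conj y) :=
  ext_htmul fun ξ η => by simp only [conj_apply, tensor_htmul, opTensor_htmul]

theorem conj_one (J : AntilinearInvolution H) : J.conj 1 = 1 :=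
  ContinuousLinearMap.ext fun ξ => by
    rw [conj_apply, one_apply_eq_self, J.involutive, one_apply_eq_self]

theorem conj_flipCLM (J : AntilinearInvolution H) : (J.tensor J).conj (flipCLM H) = flipCLM H :=
  ext_htmul fun ξ η => by simp only [conj_apply, tensor_htmul, flipCLM_htmul, J.involutive]

theorem conj_leg12 (J₁ J₂ J₃ : AntilinearInvolution H) (X : HTensor H H →L[ℂ] HTensor H H) :
    ((J₁.tensor J₂).tensor J₃).conj (leg12 X) = leg12 ((J₁.tensor J₂).conj X) := by
  rw [leg12, conj_opTensor, conj_one, leg12]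

theorem tensor_tensor_assoc_symm (J₁ J₂ J₃ : AntilinearInvolution H)
    (z : HTensor H (HTensor H H)) :
    ((J₁.tensor J₂).tensor J₃).toLinearMap ((assoc H H H).symm z) =
      (assoc H H H).symm ((J₁.tensor (J₂.tensor J₃)).toLinearMap z) := by
  obtain ⟨z, rfl⟩ := (assoc H H H).surjective z
  refine (assoc H H H).injective ?_
  rw [LinearIsometryEquiv.symm_apply_apply, LinearIsometryEquiv.apply_symm_apply]
  have h : ((assoc H H H : HTensor (HTensor H H) H →L[ℂ] HTensor H (HTensor H H)).comp
      ((J₁.tensor J₂).tensor J₃).toCLM) = (J₁.tensor (J₂.tensor J₃)).toCLM.comp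
        (assoc H H H : HTensor (HTensor H H) H →L[ℂ] HTensor H (HTensor H H)) :=
    ext_htmul₃ fun a b c => by
      change assoc H H H (((J₁.tensor J₂).tensor J₃).toLinearMap (htmul (htmul a b) c)) =
        (J₁.tensor (J₂.tensor J₃)).toLinearMap (assoc H H H (htmul (htmul a b) c))
      simp only [tensor_htmul, assoc_htmul]
  exact congrArg (· z) h

theorem conj_leg23 (J₁ J₂ J₃ : AntilinearInvolution H) (X : HTensor H H →L[ℂ] HTensor H H) :
    ((J₁.tensor J₂).tensor J₃).conj (leg23 X) = leg23 ((J₂.tensor J₃).conj X) :=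
  ext_htmul₃ fun a b c => by
    simp only [conj_apply, tensor_htmul, leg23_htmul, tensor_tensor_assoc_symm, J₁.involutive]

end Conj

section VonNeumann

variable {H : Type u} [NormedAddCommGroup H] [InnerProductSpace ℂ H] [CompleteSpace H]

/-- The bounded linear map `x ↦ J x* J`. -/
noncomputable def conjStar (J : AntilinearInvolution H) : (H →L[ℂ] H) →L[ℂ] (H →L[ℂ] H) :=
  LinearMap.mkContinuous
    { toFun := fun x => J.conj (star x)
      map_add' := fun x y => by rw [star_add, conj_add]
      map_smul' := fun c x => by rw [star_smul, conj_smul, star_star, RingHom.id_apply] }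
    1 fun x => by
      rw [one_mul, ← norm_star x]
      exact J.norm_conj_le _

theorem conjStar_apply (J : AntilinearInvolution H) (x : H →L[ℂ] H) :
    J.conjStar x = J.conj (star x) := rfl

theorem comp_conjStar_mem_predual (J : AntilinearInvolution H) {ω : (H →L[ℂ] H) →L[ℂ] ℂ}
    (hω : ω ∈ predual H) : ω.comp J.conjStar ∈ predual H := by
  obtain ⟨ξ, η, hξ, hη, h⟩ := hω
  refine ⟨fun n => J.toLinearMap (η n), fun n => J.toLinearMap (ξ n), ?_, ?_, fun x => ?_⟩
  · simpa only [J.norm_map] using hη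
  · simpa only [J.norm_map] using hξ
  · refine (congrArg (HasSum · _) (funext fun n => ?_)).mp (h (J.conjStar x))
    rw [conjStar_apply, conj_apply, ← inner_conj_symm, J.selfAdjoint, inner_conj_symm,
      ContinuousLinearMap.star_eq_adjoint, ← ContinuousLinearMap.adjoint_inner_left]

/-- A map is continuous for the topology induced by a family of functions if composition with it
maps the family into itself. -/
theorem continuous_induced_of_forall_exists {X Y ι : Type*} [TopologicalSpace Y] {f : X → ι → Y}
    {T : X → X} (h : ∀ i, ∃ j, ∀ x, f (T x) i = f x j) :
    Continuous[.induced f inferInstance, .induced f inferInstance] T := by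
  let : TopologicalSpace X := .induced f inferInstance
  refine continuous_induced_rng.2 (continuous_pi fun i => ?_)
  obtain ⟨j, hj⟩ := h i
  simp only [Function.comp_apply, hj]
  exact (continuous_apply j).comp continuous_induced_dom

theorem continuous_conjStar (J : AntilinearInvolution H) :
    Continuous[sigmaWeak H, sigmaWeak H] J.conjStar :=
  continuous_induced_of_forall_exists fun ω =>
    ⟨⟨_, J.comp_conjStar_mem_predual ω.2⟩, fun _ => rfl⟩

/-- If `J S J` is contained in the von Neumann algebra generated by `S`, then `J` normalises it. -/
theorem conj_mem_generatedVN (J : AntilinearInvolution H) {S : Set (H →L[ℂ] H)}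
    (hS : ∀ s ∈ S, J.conj s ∈ generatedVN S) {x : H →L[ℂ] H} (hx : x ∈ generatedVN S) :
    J.conj x ∈ generatedVN S := by
  rw [mem_generatedVN_iff]
  intro T h1 h2
  have h1' : ∀ s ∈ S, Commute T (J.conj s) := fun s hs =>
    (mem_generatedVN_iff S _).1 (hS s hs) T h1 h2
  have h2' : ∀ s ∈ S, Commute (star T) (J.conj s) := fun s hs =>
    (mem_generatedVN_iff S _).1 (hS s hs) _ h2 (by rwa [star_star])
  have h := (mem_generatedVN_iff S x).1 hx (J.conj T) (fun s hs => J.commute_conj (h1' s hs))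
    (fun s hs => by rw [← conj_star]; exact J.commute_conj (h2' s hs))
  have h' := J.commute_conj (x := x) (y := T) h.symm
  exact h'.symm

theorem conj_mem_vnTensor (J : AntilinearInvolution H) {M : VonNeumannAlgebra H}
    (hM : ∀ m ∈ M, J.conj m ∈ M) {X : HTensor H H →L[ℂ] HTensor H H} (hX : X ∈ vnTensor M) :
    (J.tensor J).conj X ∈ vnTensor M := by
  refine conj_mem_generatedVN _ ?_ hX
  rintro _ ⟨a, ha, b, hb, rfl⟩
  rw [conj_opTensor]
  exact subset_generatedVN _ ⟨_, hM a ha, _, hM b hb, rfl⟩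

/-- The `*`-anti-automorphism `m ↦ J m* J` of a von Neumann algebra normalised by `J`. -/
noncomputable def antiAut (J : AntilinearInvolution H) {M : VonNeumannAlgebra H}
    (hM : ∀ m ∈ M, J.conj m ∈ M) : Alg M ≃⋆ₐ[ℂ] (Alg M)ᵐᵒᵖ where
  toFun m := MulOpposite.op ⟨J.conj (star (m : H →L[ℂ] H)), hM _ (star_mem (s := M) m.2)⟩
  invFun m := ⟨J.conj (star (m.unop : H →L[ℂ] H)), hM _ (star_mem (s := M) m.unop.2)⟩
  left_inv m := Subtype.ext <| by
    change J.conj (star (J.conj (star (m : H →L[ℂ] H)))) = m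
    rw [← conj_star, star_star, conj_conj]
  right_inv m := MulOpposite.unop_injective <| Subtype.ext <| by
    change J.conj (star (J.conj (star (m.unop : H →L[ℂ] H)))) = m.unop
    rw [← conj_star, star_star, conj_conj]
  map_mul' x y := MulOpposite.unop_injective <| Subtype.ext <| by
    change J.conj (star ((x : H →L[ℂ] H) * (y : H →L[ℂ] H))) =
      J.conj (star (y : H →L[ℂ] H)) * J.conj (star (x : H →L[ℂ] H))
    rw [star_mul, conj_mul]
  map_add' x y := MulOpposite.unop_injective <| Subtype.ext <| by
    change J.conj (star ((x : H →L[ℂ] H) + (y : H →L[ℂ] H))) =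
      J.conj (star (x : H →L[ℂ] H)) + J.conj (star (y : H →L[ℂ] H))
    rw [star_add, conj_add]
  map_star' x := MulOpposite.unop_injective <| Subtype.ext <| by
    change J.conj (star (star (x : H →L[ℂ] H))) = star (J.conj (star (x : H →L[ℂ] H)))
    rw [← conj_star]
  map_smul' c x := MulOpposite.unop_injective <| Subtype.ext <| by
    exact map_smul J.conjStar c (x : H →L[ℂ] H)

/-- The linear map `X ↦ (J ⊗ J) X* (J ⊗ J)` on `M ⊗ M`, for a von Neumann algebra `M` normalised
by `J`. -/
noncomputable def tensorSquare (J : AntilinearInvolution H) {M : VonNeumannAlgebra H}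
    (hM : ∀ m ∈ M, J.conj m ∈ M) : Alg (vnTensor M) →ₗ[ℂ] Alg (vnTensor M) :=
  ((J.tensor J).conjStar.toLinearMap.comp
    (vnTensor M).toStarSubalgebra.toSubalgebra.toSubmodule.subtype).codRestrict
      (vnTensor M).toStarSubalgebra.toSubalgebra.toSubmodule
      fun X => J.conj_mem_vnTensor hM (star_mem (s := vnTensor M) X.2)

theorem isTensorSquare_tensorSquare (J : AntilinearInvolution H) {M : VonNeumannAlgebra H}
    (hM : ∀ m ∈ M, J.conj m ∈ M) :
    IsTensorSquare (fun m => (J.antiAut hM m).unop) (J.tensorSquare hM) where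
  continuous_sigmaWeak := by
    let := sigmaWeak (HTensor H H)
    let := sigmaWeakOn (vnTensor M)
    exact continuous_induced_rng.2 ((J.tensor J).continuous_conjStar.comp continuous_induced_dom)
  map_vnTmul a b := Subtype.ext <| by
    change (J.tensor J).conj (star (opTensor (a : H →L[ℂ] H) (b : H →L[ℂ] H))) =
      opTensor (J.conj (star (a : H →L[ℂ] H))) (J.conj (star (b : H →L[ℂ] H)))
    rw [← opTensor_star, conj_opTensor]

end VonNeumann

end AntilinearInvolution

/-! ### The unitary antipode -/

section Antipode

variable {H : Type u} [NormedAddCommGroup H] [InnerProductSpace ℂ H] [CompleteSpace H]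

theorem conj_mem_algM {W : HTensor H H →L[ℂ] HTensor H H} {A B : AntilinearInvolution H}
    (hWAB : star W = (A.tensor B).conj W) : ∀ m ∈ algM W, A.conj m ∈ algM W := by
  -- if `T ⊗ 1` commutes with `W`, then `A T* A ⊗ 1` commutes with `(A ⊗ B) W* (A ⊗ B) = W`
  have key : ∀ T : H →L[ℂ] H, Commute (opTensor T 1) W →
      Commute (opTensor (star (A.conj T)) 1) W := by
    intro T hT
    have hW : W = (A.tensor B).conj (star W) := by
      rw [hWAB, AntilinearInvolution.conj_conj]
    rw [hW] at hT
    have h := (A.tensor B).commute_conj hT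
    rw [AntilinearInvolution.conj_opTensor, AntilinearInvolution.conj_one] at h
    have h' := h.star_star
    rwa [star_star, ← opTensor_star, star_one] at h'
  intro m hm
  rw [mem_algM_iff]
  intro T h1 h2
  have k1 := key _ h2
  rw [AntilinearInvolution.conj_star, star_star] at k1
  exact (A.commute_conj (x := m) (y := T) ((mem_algM_iff W m).1 hm _ k1 (key _ h1)).symm).symm

/-- With `κ` the conjugation by `A ⊗ A`, the operator `U = W κ(Σ W*)` satisfies that `U₁₂` commutes
with `W₂₃`: since `(A ⊗ A ⊗ B)` conjugates `W₁₃ W₂₃` to `W₁₃* W₂₃*`, both sides reduce to the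
adjoint of the pentagon equation. -/
theorem IsMultiplicativeUnitary.commute_leg12_conj_flip {W : HTensor H H →L[ℂ] HTensor H H}
    (hW : IsMultiplicativeUnitary W) {A B : AntilinearInvolution H}
    (hWAB : star W = (A.tensor B).conj W) :
    Commute (leg12 (W * (A.tensor A).conj (flipCLM H * star W))) (leg23 W) := by
  have hp := congrArg star hW.pentagon
  simp only [star_mul, ← leg12_star, ← leg13_star, ← leg23_star] at hp
  have h23 : leg23 (star W) = ((A.tensor A).tensor B).conj (leg23 W) := by
    rw [AntilinearInvolution.conj_leg23, hWAB]
  have h13 : leg13 (star W) = ((A.tensor A).tensor B).conj (leg13 W) := by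
    rw [leg13_eq', leg13_eq', h23, AntilinearInvolution.conj_mul, AntilinearInvolution.conj_mul,
      AntilinearInvolution.conj_leg12, AntilinearInvolution.conj_flipCLM]
  have key : leg13 (star W) * leg23 (star W) * (leg12 (flipCLM H) * leg12 (star W)) =
      leg12 (flipCLM H) * leg12 (star W) * leg23 (star W) := by
    rw [mul_assoc (leg12 (flipCLM H)), ← hp, leg13_eq' (star W)]
    simp only [mul_assoc]
  have key' := congrArg ((A.tensor A).tensor B).conj key
  rw [h23, h13] at key'
  simp only [AntilinearInvolution.conj_mul, AntilinearInvolution.conj_conj] at key'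
  have h1 : leg23 W * leg12 W = leg12 W * (leg13 W * leg23 W) := by
    rw [← hW.pentagon, mul_assoc]
  rw [Commute, SemiconjBy, leg12_mul, ← AntilinearInvolution.conj_leg12 A A B, leg12_mul,
    AntilinearInvolution.conj_mul, mul_assoc, ← key', ← mul_assoc (leg23 W), h1]
  simp only [mul_assoc]

/-- The identity `W* (1 ⊗ A m A) W = σ ((A ⊗ A) W* (1 ⊗ m) W (A ⊗ A))` for `m ∈ M`. -/
theorem IsMultiplicativeUnitary.comul_conj {W : HTensor H H →L[ℂ] HTensor H H}
    (hW : IsMultiplicativeUnitary W) {A B : AntilinearInvolution H}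
    (hWAB : star W = (A.tensor B).conj W) {m : H →L[ℂ] H} (hm : m ∈ algM W) :
    comul W (A.conj m) = flipOp ((A.tensor A).conj (comul W m)) := by
  obtain ⟨hW1, hW2⟩ := Unitary.mem_iff.1 hW.mem_unitary
  have hc := hW.commute_leg12_conj_flip hWAB
  set κ := (A.tensor A).conj with hκ
  have hκm : ∀ X Y, κ (X * Y) = κ X * κ Y := (A.tensor A).conj_mul
  have hκs : ∀ X, κ (star X) = star (κ X) := (A.tensor A).conj_star
  have hκ1 : κ 1 = 1 := (A.tensor A).conj_one
  have hκκ : ∀ X, κ (κ X) = X := (A.tensor A).conj_conj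
  have hf := flipCLM_mul_self (H := H)
  have hU1 : star (W * κ (flipCLM H * star W)) * (W * κ (flipCLM H * star W)) = 1 := by
    rw [star_mul, ← hκs, mul_assoc, ← mul_assoc (star W), hW1, one_mul, ← hκm, star_mul,
      star_star, star_flipCLM, mul_assoc, ← mul_assoc (flipCLM H), hf, one_mul, hW2, hκ1]
  have hU2 : (W * κ (flipCLM H * star W)) * star (W * κ (flipCLM H * star W)) = 1 := by
    rw [star_mul, ← hκs, mul_assoc, ← mul_assoc (κ _), ← hκm, star_mul,
      star_star, star_flipCLM, mul_assoc, ← mul_assoc (star W), hW1, one_mul, hf, hκ1, one_mul, hW2]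
  -- `U₁₂` is unitary, so its adjoint commutes with `W₂₃` as well
  have hc' : Commute (leg12 (star (W * κ (flipCLM H * star W)))) (leg23 W) := by
    have e1 := congrArg leg12 hU1
    have e2 := congrArg leg12 hU2
    rw [leg12_mul, leg12_one] at e1 e2
    exact Commute.units_inv_left (u := ⟨_, _, e2, e1⟩) hc
  have h := (commute_opTensor_one_of_leg hc hc' hm).eq
  have h1 : κ (flipCLM H * star W) * opTensor 1 m = comul W m * κ (flipCLM H * star W) := by
    calc _ = star W * W * κ (flipCLM H * star W) * opTensor 1 m := by rw [hW1, one_mul]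
      _ = star W * (W * κ (flipCLM H * star W) * opTensor 1 m) := by simp only [mul_assoc]
      _ = _ := by rw [h, comul]; simp only [mul_assoc]
  have h2 := congrArg κ h1
  rw [hκm (κ _), hκm (comul W m), hκκ] at h2
  have h3 : κ (opTensor 1 m) = opTensor 1 (A.conj m) := by
    rw [hκ, AntilinearInvolution.conj_opTensor, AntilinearInvolution.conj_one]
  rw [h3] at h2
  calc comul W (A.conj m)
      = flipCLM H * flipCLM H * star W * opTensor 1 (A.conj m) * W := by rw [hf, one_mul]; rfl
    _ = flipCLM H * (flipCLM H * star W * opTensor 1 (A.conj m)) * W := by simp only [mul_assoc]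
    _ = flipCLM H * κ (comul W m) * flipCLM H * (star W * W) := by rw [h2]; simp only [mul_assoc]
    _ = _ := by rw [hW1, mul_one, flipOp_eq]

/-- The comultiplication and the unitary antipode of `M`, for a multiplicative unitary compatible
with a pair of antilinear involutions. -/
theorem IsMultiplicativeUnitary.exists_unitaryAntipode {W : HTensor H H →L[ℂ] HTensor H H}
    (hW : IsMultiplicativeUnitary W) {A B : AntilinearInvolution H}
    (hWAB : star W = (A.tensor B).conj W) :
    ∃ (R : Alg (algM W) ≃⋆ₐ[ℂ] (Alg (algM W))ᵐᵒᵖ)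
      (Φ : Alg (algM W) →⋆ₐ[ℂ] Alg (vnTensor (algM W)))
      (RR : Alg (vnTensor (algM W)) →ₗ[ℂ] Alg (vnTensor (algM W))),
      (∀ m, ((R m).unop : H →L[ℂ] H) = A.conj (star (m : H →L[ℂ] H))) ∧
      (∀ m, (Φ m : HTensor H H →L[ℂ] HTensor H H) = comul W m) ∧
      IsTensorSquare (fun m => (R m).unop) RR ∧
      ∀ m, (Φ (R m).unop : HTensor H H →L[ℂ] HTensor H H) = flipOp (RR (Φ m)) := by
  have hM := conj_mem_algM hWAB
  refine ⟨A.antiAut hM, comulHom hW, A.tensorSquare hM, fun _ => rfl, fun _ => rfl,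
    A.isTensorSquare_tensorSquare hM, fun m => ?_⟩
  have h : comul W (star (m : H →L[ℂ] H)) = star (comul W m) :=
    congrArg Subtype.val (map_star (comulHom hW) m)
  exact (hW.comul_conj hWAB (star_mem m.2)).trans (by rw [h]; rfl)

/-- The dual unitary satisfies the compatibility condition with the roles of the two involutions
exchanged. -/
theorem star_dualUnitary {W : HTensor H H →L[ℂ] HTensor H H} {A B : AntilinearInvolution H}
    (hWAB : star W = (A.tensor B).conj W) :
    star (dualUnitary W) = (B.tensor A).conj (dualUnitary W) := by
  have hf (J J' : AntilinearInvolution H) (z : HTensor H H) :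
      flipCLM H ((J.tensor J').toLinearMap z) = (J'.tensor J).toLinearMap (flipCLM H z) := by
    have h : (flipCLM H).comp (J.tensor J').toCLM = (J'.tensor J).toCLM.comp (flipCLM H) :=
      ext_htmul fun a b => by
        change flipCLM H ((J.tensor J').toLinearMap (htmul a b)) =
          (J'.tensor J).toLinearMap (flipCLM H (htmul a b))
        simp only [AntilinearInvolution.tensor_htmul, flipCLM_htmul]
    exact congrArg (· z) h
  have hW : W = (A.tensor B).conj (star W) := by rw [hWAB, AntilinearInvolution.conj_conj]
  rw [dualUnitary, ← flipOp_star, star_star]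
  refine ContinuousLinearMap.ext fun z => ?_
  conv_lhs => rw [hW]
  simp only [flipOp_eq, mul_apply_eq_comp, AntilinearInvolution.conj_apply, hf]

end Antipode

end QGF

theorem mainTheorem6 {H : Type*} [NormedAddCommGroup H] [InnerProductSpace ℂ H] [CompleteSpace H]
    (F : QGF.QuantumGroupFrame H) :
    (∃ (R : QGF.Alg F.M ≃⋆ₐ[ℂ] (QGF.Alg F.M)ᵐᵒᵖ)
      (Φ : QGF.Alg F.M →⋆ₐ[ℂ] QGF.Alg (QGF.vnTensor F.M))
      (RR : QGF.Alg (QGF.vnTensor F.M) →ₗ[ℂ] QGF.Alg (QGF.vnTensor F.M)),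
      (∀ m, ((R m).unop : H →L[ℂ] H) = F.Jhat.conj (star (m : H →L[ℂ] H))) ∧
      (∀ m, (Φ m : QGF.HTensor H H →L[ℂ] QGF.HTensor H H) = QGF.comul F.W m) ∧
      QGF.IsTensorSquare (fun m => (R m).unop) RR ∧
      ∀ m, (Φ (R m).unop : QGF.HTensor H H →L[ℂ] QGF.HTensor H H) =
        QGF.flipOp (RR (Φ m))) ∧
    (∃ (R : QGF.Alg F.Mhat ≃⋆ₐ[ℂ] (QGF.Alg F.Mhat)ᵐᵒᵖ)
      (Φ : QGF.Alg F.Mhat →⋆ₐ[ℂ] QGF.Alg (QGF.vnTensor F.Mhat))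
      (RR : QGF.Alg (QGF.vnTensor F.Mhat) →ₗ[ℂ] QGF.Alg (QGF.vnTensor F.Mhat)),
      (∀ x, ((R x).unop : H →L[ℂ] H) = F.J.conj (star (x : H →L[ℂ] H))) ∧
      (∀ x, (Φ x : QGF.HTensor H H →L[ℂ] QGF.HTensor H H) =
        QGF.comul (QGF.dualUnitary F.W) x) ∧
      QGF.IsTensorSquare (fun x => (R x).unop) RR ∧
      ∀ x, (Φ (R x).unop : QGF.HTensor H H →L[ℂ] QGF.HTensor H H) =
        QGF.flipOp (RR (Φ x))) := by
  refine ⟨F.isMultiplicativeUnitary.exists_unitaryAntipode F.star_W, ?_⟩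
  have h := F.isMultiplicativeUnitary.dual.exists_unitaryAntipode (QGF.star_dualUnitary F.star_W)
  unfold QGF.QuantumGroupFrame.Mhat
  rw [QGF.algMhat_eq]
  exact h
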